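/- **Notation.** Let $N=(n_{ij})\in SL(2,\mathbb Z)$ have real eigenvalues $\alpha>1$ and $1/\alpha$, let $a=(a_1,a_2)^T,\ b=(b_1,b_2)^T\in\mathbb R^2$ be eigenvectors of $N$ for $\alpha$ and $1/\alpha$, let $p,q,r\in\mathbb Z$ with $r\neq 0$, and let $t\in\mathbb C$. Put $\theta=\det(a,b)=a_1b_2-a_2b_1$, $e_i=\tfrac12 n_{i1}(n_{i1}-1)a_1b_1+\tfrac12 n_{i2}(n_{i2}-1)a_2b_2+n_{i1}n_{i2}b_1a_2$ for $i=1,2$, and let $(c_1,c_2)^T\in\mathbb R^2$ be the unique solution of $$(N-I)\begin{pmatrix}c_1\\c_2\end{pmatrix}+\begin{pmatrix}e_1\\e_2\end{pmatrix}-\frac{\theta}{r}\begin{pmatrix}p\\q\end{pmatrix}=0 .$$ Let $G^+$ be the group of automorphisms of $\mathbb H\times\mathbb C$ ($\mathbb H$ the upper half plane) generated by $$g_0:(w,z)\mapsto(\alpha w,\,z+t),\qquad g_i:(w,z)\mapsto(w+a_i,\,z+b_iw+c_i)\ (i=1,2),\qquad g_3:(w,z)\mapsto(w,\,z-\theta/r).$$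 It acts freely and properly discontinuously, and the complex surface $S^+_{N,p,q,r,t,a,b}=(\mathbb H\times\mathbb C)/G^+$ is called an *Inoue surface of type $S^+$*. Complex manifolds $S_1,S_2$ are called *deformation equivalent* if there are connected complex manifolds $\mathcal X$ and $B$, a proper holomorphic submersion $\pi:\mathcal X\to B$ and points $t_1,t_2\in B$ such that $\pi^{-1}(t_i)$ is biholomorphic to $S_i$ for $i=1,2$. *Deformation equivalence classes* of Inoue surfaces of type $S^+$ are the classes of the equivalence relation which this relation generates on these surfaces. **Proposition.** Fix an Inoue surface $S=S^+_{N,p,q,r,t,a,b}$ of type $S^+$. The Inoue surfaces of type $S^+$ that are homotopy equivalent to $S$ form at most $16$ deformation equivalence classes. More precisely, they can be divided into $16$ (possibly empty) families such that any two members of the same family are deformation equivalent, that is, occur as fibres of a single proper holomorphic submersion between connected complex manifolds. -/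

import Mathlib

open scoped Manifold ContDiff Matrix UpperHalfPlane Topology

noncomputable section

/-- `M` is a complex manifold: Hausdorff, second countable, and with a holomorphic (that is, complex
analytic) atlas modelled on a finite-dimensional complex vector space. -/
structure IsComplexManifold {E : Type*} [NormedAddCommGroup E] [NormedSpace ℂ E]
    {H : Type*} [TopologicalSpace H] (I : ModelWithCorners ℂ E H)
    (M : Type*) [TopologicalSpace M] [ChartedSpace H M] : Prop where
  finiteDimensional : FiniteDimensional ℂ E
  boundaryless : I.Boundaryless
  t2Space : T2Space M
  secondCountableTopology : SecondCountableTopology M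
  isManifold : IsManifold I ω M

section Deformation

variable {E₁ H₁ E₂ H₂ : Type*} [NormedAddCommGroup E₁] [NormedSpace ℂ E₁] [TopologicalSpace H₁]
  [NormedAddCommGroup E₂] [NormedSpace ℂ E₂] [TopologicalSpace H₂]
  (I₁ : ModelWithCorners ℂ E₁ H₁) (I₂ : ModelWithCorners ℂ E₂ H₂)

/-- The fibre over `t` of a holomorphic submersion `π : 𝒳 → B`, a closed complex submanifold of `𝒳`,
is biholomorphic to `S`: there is a holomorphic embedding of `S` into `𝒳` with image `π⁻¹(t)`. -/
def FibreBiholomorphic {𝒳 B : Type*} [TopologicalSpace 𝒳] [ChartedSpace H₂ 𝒳]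
    (π : 𝒳 → B) (t : B) (S : Type*) [TopologicalSpace S] [ChartedSpace H₁ S] : Prop :=
  ∃ f : S → 𝒳, Manifold.IsSmoothEmbedding I₁ I₂ ω f ∧ Set.range f = π ⁻¹' {t}

/-- `S₁` and `S₂` are deformation equivalent: there are connected complex manifolds `𝒳` and `B`, a
smooth (that is, submersive) proper holomorphic map `π : 𝒳 → B` and points `t₁, t₂ ∈ B` such that
`π⁻¹(tᵢ)` is biholomorphic to `Sᵢ`. -/
def DeformationEquivalent (S₁ : Type*) [TopologicalSpace S₁] [ChartedSpace H₁ S₁]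
    (S₂ : Type*) [TopologicalSpace S₂] [ChartedSpace H₂ S₂] : Prop :=
  ∃ (E : Type) (_ : NormedAddCommGroup E) (_ : NormedSpace ℂ E)
    (H : Type) (_ : TopologicalSpace H) (I : ModelWithCorners ℂ E H)
    (F : Type) (_ : NormedAddCommGroup F) (_ : NormedSpace ℂ F)
    (G : Type) (_ : TopologicalSpace G) (J : ModelWithCorners ℂ F G)
    (𝒳 : Type) (_ : TopologicalSpace 𝒳) (_ : ChartedSpace H 𝒳)
    (B : Type) (_ : TopologicalSpace B) (_ : ChartedSpace G B),
    IsComplexManifold I 𝒳 ∧ ConnectedSpace 𝒳 ∧ IsComplexManifold J B ∧ ConnectedSpace B ∧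
    ∃ π : 𝒳 → B, Manifold.IsSubmersion I J ω π ∧ IsProperMap π ∧
      ∃ t₁ t₂ : B, FibreBiholomorphic I₁ I π t₁ S₁ ∧ FibreBiholomorphic I₂ I π t₂ S₂

end Deformation

/-- The parameters of an Inoue surface of type `S⁺`: a matrix `N ∈ SL(2, ℤ)` with real eigenvalues
`α > 1` and `1 / α`, corresponding real eigenvectors `a` and `b`, integers `p, q, r` with `r ≠ 0`,
and a complex number `t`. -/
structure SPlusData where
  N : Matrix.SpecialLinearGroup (Fin 2) ℤ
  p : ℤ
  q : ℤ
  r : ℤ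
  t : ℂ
  α : ℝ
  a : Fin 2 → ℝ
  b : Fin 2 → ℝ
  r_ne_zero : r ≠ 0
  one_lt_α : 1 < α
  a_ne_zero : a ≠ 0
  b_ne_zero : b ≠ 0
  mulVec_a : (N.1.map (Int.cast : ℤ → ℝ)) *ᵥ a = α • a
  mulVec_b : (N.1.map (Int.cast : ℤ → ℝ)) *ᵥ b = α⁻¹ • b

namespace SPlusData

variable (D : SPlusData)

/-- The matrix `N`, viewed as a real matrix. -/
def realN : Matrix (Fin 2) (Fin 2) ℝ := D.N.1.map (Int.cast : ℤ → ℝ)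

/-- `θ = det (a, b)`. -/
def θ : ℝ := D.a 0 * D.b 1 - D.a 1 * D.b 0

/-- The vector `e` with `e_i = n_{i1} (n_{i1} - 1) a_1 b_1 / 2 + n_{i2} (n_{i2} - 1) a_2 b_2 / 2 +
n_{i1} n_{i2} b_1 a_2`. -/
def e (i : Fin 2) : ℝ :=
  1 / 2 * D.realN i 0 * (D.realN i 0 - 1) * D.a 0 * D.b 0
    + 1 / 2 * D.realN i 1 * (D.realN i 1 - 1) * D.a 1 * D.b 1
    + D.realN i 0 * D.realN i 1 * D.b 0 * D.a 1

/-- The vector `c`, the solution of `(N - I) c + e - (θ / r) (p, q)ᵀ = 0`;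
see `SPlusData.c_spec` and `SPlusData.isUnit_det`. -/
def c : Fin 2 → ℝ :=
  (D.realN - 1)⁻¹ *ᵥ ((D.θ / D.r) • ![(D.p : ℝ), (D.q : ℝ)] - D.e)

lemma α_pos : 0 < D.α := one_pos.trans D.one_lt_α

lemma N_a (i : Fin 2) : D.realN i 0 * D.a 0 + D.realN i 1 * D.a 1 = D.α * D.a i := by
  simpa [Matrix.mulVec, dotProduct, Fin.sum_univ_two] using! congrFun D.mulVec_a i

lemma N_b (i : Fin 2) : D.realN i 0 * D.b 0 + D.realN i 1 * D.b 1 = D.α⁻¹ * D.b i := by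
  simpa [Matrix.mulVec, dotProduct, Fin.sum_univ_two] using! congrFun D.mulVec_b i

lemma det_realN : D.realN 0 0 * D.realN 1 1 - D.realN 0 1 * D.realN 1 0 = 1 := by
  have h := D.N.2
  rw [Matrix.det_fin_two] at h
  simp only [realN, Matrix.map_apply]
  exact_mod_cast h

lemma θ_ne_zero : D.θ ≠ 0 := by
  intro h
  unfold θ at h
  have h0 := D.N_a 0
  have h1 := D.N_a 1
  have k0 := D.N_b 0
  have k1 := D.N_b 1
  have hα := D.one_lt_α
  have hne : D.α - D.α⁻¹ ≠ 0 := by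
    have := inv_lt_one_of_one_lt₀ hα
    linarith
  have e00 : D.a 0 * D.b 0 = 0 := (mul_eq_zero.1 (by
    linear_combination (-D.b 0) * h0 + D.a 0 * k0 - D.realN 0 1 * h :
      (D.α - D.α⁻¹) * (D.a 0 * D.b 0) = 0)).resolve_left hne
  have e11 : D.a 1 * D.b 1 = 0 := (mul_eq_zero.1 (by
    linear_combination (-D.b 1) * h1 + D.a 1 * k1 + D.realN 1 0 * h :
      (D.α - D.α⁻¹) * (D.a 1 * D.b 1) = 0)).resolve_left hne
  have e01 : D.a 0 * D.b 1 = 0 := (mul_eq_zero.1 (by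
    linear_combination (-D.b 1) * h0 + D.a 1 * k0 + (D.realN 0 0 - D.α⁻¹) * h :
      (D.α - D.α⁻¹) * (D.a 0 * D.b 1) = 0)).resolve_left hne
  have e10 : D.a 1 * D.b 0 = 0 := by linarith
  have ha : D.a 0 = 0 ∧ D.a 1 = 0 ∨ D.b 0 = 0 ∧ D.b 1 = 0 := by
    simp only [mul_eq_zero] at e00 e11 e01 e10
    tauto
  rcases ha with ⟨u, v⟩ | ⟨u, v⟩
  · exact D.a_ne_zero (by ext i; fin_cases i <;> simp [u, v])
  · exact D.b_ne_zero (by ext i; fin_cases i <;> simp [u, v])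

lemma isUnit_det : IsUnit (D.realN - 1).det := by
  have h0 := D.N_a 0
  have h1 := D.N_a 1
  have k0 := D.N_b 0
  have k1 := D.N_b 1
  have hα := D.one_lt_α
  have hα' := inv_lt_one_of_one_lt₀ hα
  have key : (D.realN - 1).det * D.θ = (D.α - 1) * (D.α⁻¹ - 1) * D.θ := by
    rw [Matrix.det_fin_two]
    simp only [Matrix.sub_apply, Matrix.one_apply_eq, θ,
      Matrix.one_apply_ne (zero_ne_one' (Fin 2)), Matrix.one_apply_ne (one_ne_zero' (Fin 2)),
      sub_zero]
    have u0 : (D.realN 0 0 - 1) * D.a 0 + D.realN 0 1 * D.a 1 = (D.α - 1) * D.a 0 := by linarith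
    have u1 : D.realN 1 0 * D.a 0 + (D.realN 1 1 - 1) * D.a 1 = (D.α - 1) * D.a 1 := by linarith
    have v0 : (D.realN 0 0 - 1) * D.b 0 + D.realN 0 1 * D.b 1 = (D.α⁻¹ - 1) * D.b 0 := by linarith
    have v1 : D.realN 1 0 * D.b 0 + (D.realN 1 1 - 1) * D.b 1 = (D.α⁻¹ - 1) * D.b 1 := by linarith
    calc _ = ((D.realN 0 0 - 1) * D.a 0 + D.realN 0 1 * D.a 1)
            * (D.realN 1 0 * D.b 0 + (D.realN 1 1 - 1) * D.b 1)
          - (D.realN 1 0 * D.a 0 + (D.realN 1 1 - 1) * D.a 1)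
            * ((D.realN 0 0 - 1) * D.b 0 + D.realN 0 1 * D.b 1) := by ring
      _ = _ := by rw [u0, u1, v0, v1]; ring
  rw [isUnit_iff_ne_zero, mul_right_cancel₀ D.θ_ne_zero key]
  exact mul_ne_zero (by linarith) (by linarith)

lemma c_spec : (D.realN - 1) *ᵥ D.c + D.e - (D.θ / D.r) • ![(D.p : ℝ), (D.q : ℝ)] = 0 := by
  rw [c, Matrix.mulVec_mulVec, Matrix.mul_nonsing_inv _ D.isUnit_det, Matrix.one_mulVec]
  abel

/-- The generator `g₀ : (w, z) ↦ (α w, z + t)`. -/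
def g₀ : (ℍ × ℂ) ≃ₜ (ℍ × ℂ) where
  toFun x := ((⟨D.α, D.α_pos⟩ : {s : ℝ // 0 < s}) • x.1, x.2 + D.t)
  invFun x := ((⟨D.α, D.α_pos⟩ : {s : ℝ // 0 < s})⁻¹ • x.1, x.2 - D.t)
  left_inv x := by simp
  right_inv x := by simp
  continuous_toFun := by
    have := (UpperHalfPlane.isometry_pos_mul ⟨D.α, D.α_pos⟩).continuous
    fun_prop
  continuous_invFun := by
    have := (UpperHalfPlane.isometry_pos_mul (⟨D.α, D.α_pos⟩ : {s : ℝ // 0 < s})⁻¹).continuous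
    fun_prop

/-- The generators `g_i : (w, z) ↦ (w + a_i, z + b_i w + c_i)`. -/
def g (i : Fin 2) : (ℍ × ℂ) ≃ₜ (ℍ × ℂ) where
  toFun x := (D.a i +ᵥ x.1, x.2 + D.b i * x.1 + D.c i)
  invFun x := (-D.a i +ᵥ x.1, x.2 - D.b i * (x.1 - D.a i) - D.c i)
  left_inv x := by ext <;> simp; ring
  right_inv x := by ext <;> simp; ring
  continuous_toFun := by
    have := (UpperHalfPlane.isometry_real_vadd (D.a i)).continuous
    have := UpperHalfPlane.continuous_coe
    fun_prop
  continuous_invFun := by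
    have := (UpperHalfPlane.isometry_real_vadd (-D.a i)).continuous
    have := UpperHalfPlane.continuous_coe
    fun_prop

/-- The generator `g₃ : (w, z) ↦ (w, z - θ / r)`. -/
def g₃ : (ℍ × ℂ) ≃ₜ (ℍ × ℂ) where
  toFun x := (x.1, x.2 - (D.θ / D.r : ℝ))
  invFun x := (x.1, x.2 + (D.θ / D.r : ℝ))
  left_inv x := by simp
  right_inv x := by simp
  continuous_toFun := by fun_prop
  continuous_invFun := by fun_prop

lemma g₀_apply (x : ℍ × ℂ) :
    D.g₀ x = ((⟨D.α, D.α_pos⟩ : {s : ℝ // 0 < s}) • x.1, x.2 + D.t) := rfl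

lemma g₀_inv_apply (x : ℍ × ℂ) :
    D.g₀⁻¹ x = ((⟨D.α, D.α_pos⟩ : {s : ℝ // 0 < s})⁻¹ • x.1, x.2 - D.t) := rfl

lemma g_apply (i : Fin 2) (x : ℍ × ℂ) :
    D.g i x = (D.a i +ᵥ x.1, x.2 + D.b i * x.1 + D.c i) := rfl

lemma g_inv_apply (i : Fin 2) (x : ℍ × ℂ) :
    (D.g i)⁻¹ x = (-D.a i +ᵥ x.1, x.2 - D.b i * (x.1 - D.a i) - D.c i) := rfl

lemma g₃_apply (x : ℍ × ℂ) : D.g₃ x = (x.1, x.2 - (D.θ / D.r : ℝ)) := rfl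

lemma g₃_inv_apply (x : ℍ × ℂ) : D.g₃⁻¹ x = (x.1, x.2 + (D.θ / D.r : ℝ)) := rfl

/-- The group `G⁺` of automorphisms of `ℍ × ℂ` generated by `g₀, g₁, g₂, g₃`. -/
def group : Subgroup ((ℍ × ℂ) ≃ₜ (ℍ × ℂ)) :=
  Subgroup.closure {D.g₀, D.g 0, D.g 1, D.g₃}

instance : MulAction D.group (ℍ × ℂ) where
  smul γ x := γ.1 x
  one_smul _ := rfl
  mul_smul _ _ _ := rfl

lemma smul_def (γ : D.group) (x : ℍ × ℂ) : γ • x = γ.1 x := rfl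

/-- The Inoue surface of type `S⁺` with the given parameters: the quotient of `ℍ × ℂ` by the
group `G⁺`, with the quotient topology. -/
def Surface : Type := MulAction.orbitRel.Quotient D.group (ℍ × ℂ)

instance : TopologicalSpace D.Surface :=
  inferInstanceAs (TopologicalSpace (MulAction.orbitRel.Quotient D.group (ℍ × ℂ)))

/-- The quotient map `ℍ × ℂ → S⁺`. -/
def proj (x : ℍ × ℂ) : D.Surface := Quotient.mk (MulAction.orbitRel D.group (ℍ × ℂ)) x

lemma c_spec' (i : Fin 2) :
    D.realN i 0 * (D.c 0 - D.a 0 * D.b 0 / 2) + D.realN i 1 * (D.c 1 - D.a 1 * D.b 1 / 2)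
      - (D.c i - D.a i * D.b i / 2)
    = (2 * ![(D.p : ℝ), (D.q : ℝ)] i + D.r * D.realN i 0 * D.realN i 1)
      * (D.θ / (2 * D.r)) := by
  have h := congrFun D.c_spec i
  have hr : (D.r : ℝ) ≠ 0 := Int.cast_ne_zero.2 D.r_ne_zero
  have ha := D.N_a i
  have hb := D.N_b i
  have hα := D.α_pos.ne'
  have hab : (D.realN i 0 * D.a 0 + D.realN i 1 * D.a 1) *
      (D.realN i 0 * D.b 0 + D.realN i 1 * D.b 1) = D.a i * D.b i := by
    rw [ha, hb]; field_simp
  have hθ : D.θ = D.a 0 * D.b 1 - D.a 1 * D.b 0 := rfl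
  have e1 : (2 * ![(D.p : ℝ), (D.q : ℝ)] i + D.r * D.realN i 0 * D.realN i 1)
      * (D.θ / (2 * D.r)) = D.θ / D.r * ![(D.p : ℝ), (D.q : ℝ)] i
        + D.realN i 0 * D.realN i 1 * (D.a 0 * D.b 1 - D.a 1 * D.b 0) / 2 := by
    rw [← hθ]; field_simp
  rw [e1]
  simp only [Matrix.sub_mulVec, Matrix.one_mulVec, Pi.sub_apply, Pi.add_apply, Pi.smul_apply,
    smul_eq_mul, Pi.zero_apply, e, Matrix.mulVec, dotProduct, Fin.sum_univ_two] at h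
  linear_combination h - hab / 2

/-- Every element of the group is of the form
`(w, z) ↦ (α ^ k (w + m a₁ + n a₂), z + (m b₁ + n b₂) w + k t + d)` with `d` a real number that
lies in `θ / (2 r) ℤ` if `m = n = 0`. -/
lemma group_form {γ : (ℍ × ℂ) ≃ₜ (ℍ × ℂ)} (hγ : γ ∈ D.group) :
    ∃ k m n y : ℤ, ∀ x : ℍ × ℂ,
      ((γ x).1 : ℂ) = ((D.α ^ k : ℝ) : ℂ) * (x.1 + (m * D.a 0 + n * D.a 1 : ℝ)) ∧
      (γ x).2 = x.2 + (m * D.b 0 + n * D.b 1 : ℝ) * x.1 + k * D.t +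
        (m * (D.c 0 - D.a 0 * D.b 0 / 2) + n * (D.c 1 - D.a 1 * D.b 1 / 2)
          + 1 / 2 * (m * D.a 0 + n * D.a 1) * (m * D.b 0 + n * D.b 1)
          + y * (D.θ / (2 * D.r)) : ℝ) := by
  have hr : (D.r : ℝ) ≠ 0 := Int.cast_ne_zero.2 D.r_ne_zero
  have hα := D.α_pos.ne'
  have hθ : D.r * (D.θ / (2 * D.r)) = (D.a 0 * D.b 1 - D.a 1 * D.b 0) / 2 := by
    rw [show D.a 0 * D.b 1 - D.a 1 * D.b 0 = D.θ from rfl]; field_simp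
  have hθ2 : 2 * (D.θ / (2 * D.r)) = D.θ / D.r := by field_simp
  have hdet := D.det_realN
  have a0 := D.N_a 0
  have a1 := D.N_a 1
  have b0 := D.N_b 0
  have b1 := D.N_b 1
  have s0 := D.c_spec' 0
  have s1 := D.c_spec' 1
  simp only [Matrix.cons_val_zero, Matrix.cons_val_one] at s0 s1
  set c0 := D.c 0 - D.a 0 * D.b 0 / 2 with hc0
  set c1 := D.c 1 - D.a 1 * D.b 1 / 2 with hc1
  set τ := D.θ / (2 * D.r) with hτ
  have n00 : D.realN 0 0 = (D.N.1 0 0 : ℤ) := rfl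
  have n01 : D.realN 0 1 = (D.N.1 0 1 : ℤ) := rfl
  have n10 : D.realN 1 0 = (D.N.1 1 0 : ℤ) := rfl
  have n11 : D.realN 1 1 = (D.N.1 1 1 : ℤ) := rfl
  rw [n00, n01] at a0 b0 s0
  rw [n10, n11] at a1 b1 s1
  rw [n00, n01, n10, n11] at hdet
  clear_value τ c0 c1
  have hα' := inv_ne_zero hα
  have hαC : (D.α : ℂ) ≠ 0 := Complex.ofReal_ne_zero.2 hα
  have hθC := congrArg Complex.ofReal hθ
  have hc0C := congrArg Complex.ofReal hc0
  have hc1C := congrArg Complex.ofReal hc1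
  clear n00 n01 n10 n11
  generalize D.N.1 0 0 = u00, D.N.1 0 1 = u01, D.N.1 1 0 = u10, D.N.1 1 1 = u11 at *
  refine Subgroup.closure_induction_right (p := fun γ _ => ∃ k m n y : ℤ, ∀ x : ℍ × ℂ,
      ((γ x).1 : ℂ) = ((D.α ^ k : ℝ) : ℂ) * (x.1 + (m * D.a 0 + n * D.a 1 : ℝ)) ∧
      (γ x).2 = x.2 + (m * D.b 0 + n * D.b 1 : ℝ) * x.1 + k * D.t +
        (m * c0 + n * c1 + 1 / 2 * (m * D.a 0 + n * D.a 1) * (m * D.b 0 + n * D.b 1)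
          + y * τ : ℝ)) ⟨0, 0, 0, 0, by simp⟩ ?_ ?_ hγ
  · rintro γ - s hs ⟨k, m, n, y, h⟩
    rcases hs with rfl | rfl | rfl | rfl
    · refine ⟨k + 1, m * u11 - n * u10, n * u00 - m * u01,
        y + (m * u11 - n * u10) * (2 * D.p + D.r * u00 * u01)
          + (n * u00 - m * u01) * (2 * D.q + D.r * u10 * u11), fun x => ?_⟩
      have A : ((m * u11 - n * u10 : ℤ) : ℝ) * D.a 0 + ((n * u00 - m * u01 : ℤ) : ℝ) * D.a 1
          = (m * D.a 0 + n * D.a 1) / D.α := by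
        rw [eq_div_iff hα]; push_cast
        linear_combination (-(m * u11 - n * u10 : ℝ)) * a0 - (n * u00 - m * u01 : ℝ) * a1
          + (m * D.a 0 + n * D.a 1) * hdet
      have B : ((m * u11 - n * u10 : ℤ) : ℝ) * D.b 0 + ((n * u00 - m * u01 : ℤ) : ℝ) * D.b 1
          = (m * D.b 0 + n * D.b 1) * D.α := by
        rw [← div_inv_eq_mul _ D.α, eq_div_iff hα']; push_cast
        linear_combination (-(m * u11 - n * u10 : ℝ)) * b0 - (n * u00 - m * u01 : ℝ) * b1
          + (m * D.b 0 + n * D.b 1) * hdet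
      rw [Homeomorph.mul_apply, (h _).1, (h _).2, A, B]
      constructor
      · simp only [g₀_apply, UpperHalfPlane.coe_pos_real_smul,
          Complex.real_smul, zpow_add_one₀ hα]
        push_cast
        field_simp
      · have C : (m * c0 + n * c1 + 1 / 2 * (m * D.a 0 + n * D.a 1) * (m * D.b 0 + n * D.b 1)
            + y * τ : ℝ) = ((m * u11 - n * u10 : ℤ) : ℝ) * c0 + ((n * u00 - m * u01 : ℤ) : ℝ) * c1
            + 1 / 2 * ((m * D.a 0 + n * D.a 1) / D.α) * ((m * D.b 0 + n * D.b 1) * D.α)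
            + ((y + (m * u11 - n * u10) * (2 * D.p + D.r * u00 * u01)
              + (n * u00 - m * u01) * (2 * D.q + D.r * u10 * u11) : ℤ) : ℝ) * τ := by
          have : 1 / 2 * ((m * D.a 0 + n * D.a 1) / D.α) * ((m * D.b 0 + n * D.b 1) * D.α) =
            1 / 2 * (m * D.a 0 + n * D.a 1) * (m * D.b 0 + n * D.b 1) := by field_simp
          rw [this]
          push_cast
          linear_combination (m * u11 - n * u10 : ℝ) * s0 + (n * u00 - m * u01 : ℝ) * s1
            - (m * c0 + n * c1) * hdet
        rw [C]
        simp only [g₀_apply, UpperHalfPlane.coe_pos_real_smul,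
          Complex.real_smul]
        push_cast
        ring
    · refine ⟨k, m + 1, n, y + D.r * n, fun x => ?_⟩
      rw [Homeomorph.mul_apply, (h _).1, (h _).2]
      simp only [g_apply, UpperHalfPlane.coe_vadd]
      push_cast
      push_cast at hθC hc0C hc1C
      constructor
      · ring
      · linear_combination - hc0C - n * hθC
    · refine ⟨k, m, n + 1, y - D.r * m, fun x => ?_⟩
      rw [Homeomorph.mul_apply, (h _).1, (h _).2]
      simp only [g_apply, UpperHalfPlane.coe_vadd]
      push_cast
      push_cast at hθC hc0C hc1C
      constructor
      · ring
      · linear_combination - hc1C + m * hθC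
    · refine ⟨k, m, n, y - 2, fun x => ?_⟩
      rw [Homeomorph.mul_apply, (h _).1, (h _).2]
      simp only [g₃_apply]
      rw [← hθ2]
      push_cast
      refine ⟨trivial, ?_⟩
      ring
  · rintro γ - s hs ⟨k, m, n, y, h⟩
    rcases hs with rfl | rfl | rfl | rfl
    · refine ⟨k - 1, m * u00 + n * u10, m * u01 + n * u11,
        y - m * (2 * D.p + D.r * u00 * u01) - n * (2 * D.q + D.r * u10 * u11), fun x => ?_⟩
      have A : ((m * u00 + n * u10 : ℤ) : ℝ) * D.a 0 + ((m * u01 + n * u11 : ℤ) : ℝ) * D.a 1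
          = (m * D.a 0 + n * D.a 1) * D.α := by
        push_cast
        linear_combination m * a0 + n * a1
      have B : ((m * u00 + n * u10 : ℤ) : ℝ) * D.b 0 + ((m * u01 + n * u11 : ℤ) : ℝ) * D.b 1
          = (m * D.b 0 + n * D.b 1) * D.α⁻¹ := by
        push_cast
        linear_combination m * b0 + n * b1
      rw [Homeomorph.mul_apply, (h _).1, (h _).2, A, B]
      constructor
      · simp only [g₀_inv_apply,
          UpperHalfPlane.coe_pos_real_smul, Complex.real_smul, zpow_sub_one₀ hα, Positive.coe_inv]
        push_cast
        field_simp
      · have C : (m * c0 + n * c1 + 1 / 2 * (m * D.a 0 + n * D.a 1) * (m * D.b 0 + n * D.b 1)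
            + y * τ : ℝ) = ((m * u00 + n * u10 : ℤ) : ℝ) * c0 + ((m * u01 + n * u11 : ℤ) : ℝ) * c1
            + 1 / 2 * ((m * D.a 0 + n * D.a 1) * D.α) * ((m * D.b 0 + n * D.b 1) * D.α⁻¹)
            + ((y - m * (2 * D.p + D.r * u00 * u01) - n * (2 * D.q + D.r * u10 * u11) : ℤ) : ℝ)
              * τ := by
          have : 1 / 2 * ((m * D.a 0 + n * D.a 1) * D.α) * ((m * D.b 0 + n * D.b 1) * D.α⁻¹) =
            1 / 2 * (m * D.a 0 + n * D.a 1) * (m * D.b 0 + n * D.b 1) := by field_simp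
          rw [this]
          push_cast
          linear_combination (-m : ℝ) * s0 - n * s1
        rw [C]
        simp only [g₀_inv_apply,
          UpperHalfPlane.coe_pos_real_smul, Complex.real_smul, Positive.coe_inv]
        push_cast
        ring
    · refine ⟨k, m - 1, n, y - D.r * n, fun x => ?_⟩
      rw [Homeomorph.mul_apply, (h _).1, (h _).2]
      simp only [g_inv_apply,
        UpperHalfPlane.coe_vadd]
      push_cast
      push_cast at hθC hc0C hc1C
      constructor
      · ring
      · linear_combination hc0C + n * hθC
    · refine ⟨k, m, n - 1, y + D.r * m, fun x => ?_⟩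
      rw [Homeomorph.mul_apply, (h _).1, (h _).2]
      simp only [g_inv_apply,
        UpperHalfPlane.coe_vadd]
      push_cast
      push_cast at hθC hc0C hc1C
      constructor
      · ring
      · linear_combination hc1C - m * hθC
    · refine ⟨k, m, n, y + 2, fun x => ?_⟩
      rw [Homeomorph.mul_apply, (h _).1, (h _).2]
      simp only [g₃_inv_apply]
      rw [← hθ2]
      push_cast
      refine ⟨trivial, ?_⟩
      ring

lemma exists_nhds_disjoint (x : ℍ × ℂ) :
    ∃ U ∈ 𝓝 x, ∀ γ : D.group, ((γ • ·) '' U ∩ U).Nonempty → γ = 1 := by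
  have hα := D.one_lt_α
  have hα0 := D.α_pos
  have hr : (D.r : ℝ) ≠ 0 := Int.cast_ne_zero.2 D.r_ne_zero
  have hθ := D.θ_ne_zero
  have hc := UpperHalfPlane.continuous_coe
  have him := UpperHalfPlane.continuous_im
  have hre := UpperHalfPlane.continuous_re
  -- in terms of a point `u.1` and its image `u.2`: bounds on `k`, `m`, `n` and `y`
  have ev : ∀ᶠ u : (ℍ × ℂ) × (ℍ × ℂ) in 𝓝 (x, x),
      (u.2.1.im < D.α * u.1.1.im ∧ u.1.1.im < D.α * u.2.1.im) ∧
      |(D.b 1 * (u.2.1.re - u.1.1.re) - D.a 1 * ((u.2.2.im - u.1.2.im) / u.1.1.im)) / D.θ| < 1 ∧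
      |(D.a 0 * ((u.2.2.im - u.1.2.im) / u.1.1.im) - D.b 0 * (u.2.1.re - u.1.1.re)) / D.θ| < 1 ∧
      |(u.2.2.re - u.1.2.re) / (D.θ / (2 * D.r))| < 1 := by
    have hx := x.1.im_pos
    refine ((ContinuousAt.eventually_lt (by fun_prop) (by fun_prop) ?_).and
      (ContinuousAt.eventually_lt (by fun_prop) (by fun_prop) ?_)).and
      ((ContinuousAt.eventually_lt ?_ (by fun_prop) ?_).and
      ((ContinuousAt.eventually_lt ?_ (by fun_prop) ?_).and
      (ContinuousAt.eventually_lt (by fun_prop) (by fun_prop) ?_)))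
    · simp only; nlinarith
    · simp only; nlinarith
    · have : (x, x).1.1.im ≠ 0 := hx.ne'
      fun_prop (disch := assumption)
    · simp
    · have : (x, x).1.1.im ≠ 0 := hx.ne'
      fun_prop (disch := assumption)
    · simp
    · simp
  rw [nhds_prod_eq] at ev
  obtain ⟨U, hU, hUU⟩ := Filter.eventually_prod_self_iff'.1 ev
  refine ⟨U, hU, ?_⟩
  rintro ⟨γ, hγ⟩ ⟨_, ⟨v, hv, rfl⟩, hv'⟩
  obtain ⟨k, m, n, y, h⟩ := D.group_form hγ
  obtain ⟨⟨h1, h2⟩, h3, h4, h5⟩ := hUU v hv _ hv'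
  simp only [smul_def] at h1 h2 h3 h4 h5
  have hv0 := v.1.im_pos
  obtain ⟨f1, f2⟩ := h v
  have g1 : (γ v).1.im = D.α ^ k * v.1.im := by
    have := congrArg Complex.im f1
    rw [Complex.im_ofReal_mul, Complex.add_im, Complex.ofReal_im, add_zero] at this
    exact this
  have hk : k = 0 := by
    rw [g1] at h1 h2
    have k1 : k < 1 := by
      have : D.α ^ k < D.α ^ (1 : ℤ) := by
        rw [zpow_one]; exact lt_of_mul_lt_mul_right h1 hv0.le
      exact (zpow_lt_zpow_iff_right₀ hα).1 this
    have k2 : -1 < k := by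
      have : D.α ^ (0 : ℤ) < D.α ^ (k + 1) := by
        rw [zpow_zero, zpow_add_one₀ hα0.ne']
        nlinarith
      have := (zpow_lt_zpow_iff_right₀ hα).1 this
      omega
    omega
  subst hk
  have g2 : (γ v).1.re - v.1.re = m * D.a 0 + n * D.a 1 := by
    have := congrArg Complex.re f1
    rw [Complex.re_ofReal_mul, Complex.add_re, Complex.ofReal_re, zpow_zero, one_mul] at this
    rw [sub_eq_iff_eq_add']
    exact this
  have g3 : ((γ v).2.im - v.2.im) / v.1.im = m * D.b 0 + n * D.b 1 := by
    have := congrArg Complex.im f2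
    rw [Complex.add_im, Complex.add_im, Complex.add_im, Complex.im_ofReal_mul, Complex.ofReal_im,
      Int.cast_zero, zero_mul, Complex.zero_im, UpperHalfPlane.coe_im] at this
    rw [div_eq_iff hv0.ne', this]
    ring
  have hm : m = 0 := by
    rw [g2, g3, show D.b 1 * (m * D.a 0 + n * D.a 1) - D.a 1 * (m * D.b 0 + n * D.b 1)
      = m * D.θ by unfold θ; ring, mul_div_cancel_right₀ _ hθ] at h3
    exact Int.abs_lt_one_iff.1 (by exact_mod_cast h3)
  have hn : n = 0 := by
    rw [g2, g3, show D.a 0 * (m * D.b 0 + n * D.b 1) - D.b 0 * (m * D.a 0 + n * D.a 1)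
      = n * D.θ by unfold θ; ring, mul_div_cancel_right₀ _ hθ] at h4
    exact Int.abs_lt_one_iff.1 (by exact_mod_cast h4)
  subst hm hn
  have hy : y = 0 := by
    have : (γ v).2.re - v.2.re = y * (D.θ / (2 * D.r)) := by
      rw [f2, Complex.add_re _ (Complex.ofReal _), Complex.ofReal_re]
      simp
    rw [this, mul_div_cancel_right₀ _ (by positivity)] at h5
    exact Int.abs_lt_one_iff.1 (by exact_mod_cast h5)
  subst hy
  apply Subtype.ext
  apply Homeomorph.ext
  intro z
  obtain ⟨z1, z2⟩ := h z
  refine Prod.ext (UpperHalfPlane.ext ?_) ?_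
  · simpa using z1
  · simpa using z2

instance : ContinuousConstSMul D.group (ℍ × ℂ) := ⟨fun γ => γ.1.continuous⟩

lemma proj_eq_iff {x y : ℍ × ℂ} : D.proj x = D.proj y ↔ x ∈ MulAction.orbit D.group y :=
  Quotient.eq (r := MulAction.orbitRel D.group (ℍ × ℂ))

/-- The quotient map `ℍ × ℂ → S⁺` is a covering map with deck group `G⁺`. -/
theorem isQuotientCoveringMap_proj : IsQuotientCoveringMap D.proj D.group where
  toIsQuotientMap := isQuotientMap_quotient_mk' (s := MulAction.orbitRel D.group (ℍ × ℂ))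
  apply_eq_iff_mem_orbit := D.proj_eq_iff
  disjoint := D.exists_nhds_disjoint

theorem isLocalHomeomorph_proj : IsLocalHomeomorph D.proj :=
  D.isQuotientCoveringMap_proj.isCoveringMap.isLocalHomeomorph

/-- The charts of `S⁺` are the local inverses of the quotient map `ℍ × ℂ → S⁺`. -/
instance : ChartedSpace (ModelProd ℂ ℂ) D.Surface :=
  D.isLocalHomeomorph_proj.chartedSpace D.isQuotientCoveringMap_proj.surjective

/-- The elements of the group extend to affine maps. -/
lemma exists_contDiff {γ : (ℍ × ℂ) ≃ₜ (ℍ × ℂ)} (hγ : γ ∈ D.group) :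
    ∃ F : ℂ × ℂ → ℂ × ℂ, ContDiff ℂ ω F ∧
      ∀ x : ℍ × ℂ, F (x.1, x.2) = (((γ x).1 : ℂ), (γ x).2) := by
  obtain ⟨k, m, n, y, h⟩ := D.group_form hγ
  refine ⟨fun x => (((D.α ^ k : ℝ) : ℂ) * (x.1 + (m * D.a 0 + n * D.a 1 : ℝ)),
    x.2 + (m * D.b 0 + n * D.b 1 : ℝ) * x.1 + k * D.t +
        (m * (D.c 0 - D.a 0 * D.b 0 / 2) + n * (D.c 1 - D.a 1 * D.b 1 / 2)
          + 1 / 2 * (m * D.a 0 + n * D.a 1) * (m * D.b 0 + n * D.b 1)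
          + y * (D.θ / (2 * D.r)) : ℝ)), by fun_prop, fun x => ?_⟩
  rw [(h x).1, (h x).2]

instance : IsManifold (𝓘(ℂ, ℂ).prod 𝓘(ℂ, ℂ)) ω D.Surface := by
  refine isManifold_of_contDiffOn _ _ _ ?_
  rintro _ _ ⟨u, rfl⟩ ⟨v, rfl⟩
  generalize D.isQuotientCoveringMap_proj.surjective.hasRightInverse.choose u = u
  generalize D.isQuotientCoveringMap_proj.surjective.hasRightInverse.choose v = v
  set hp := D.isLocalHomeomorph_proj
  set Lu := hp.localInverseAt u
  set Lv := hp.localInverseAt v with hLv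
  set φ := chartAt (ModelProd ℂ ℂ) u
  set ψ := chartAt (ModelProd ℂ ℂ) v
  have hLu : ∀ x, Lu.symm x = D.proj x := fun x => congrFun (hp.localInverseAt_symm u) x
  have hφ : ∀ w ∈ φ.target, (((φ.symm w).1 : ℂ), (φ.symm w).2) = w := fun w hw => φ.right_inv hw
  intro w hw
  have hws : w ∈ ((Lu.trans φ).symm.trans (Lv.trans ψ)).source := hw.1
  have hwφ : w ∈ φ.target := by
    simp only [mfld_simps] at hws
    exact hws.1.1
  have hwv : D.proj (φ.symm w) ∈ Lv.source := by
    simp only [mfld_simps] at hws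
    rw [← hLu]
    exact hws.2.1
  obtain ⟨γ, hγ⟩ : Lv (D.proj (φ.symm w)) ∈ MulAction.orbit D.group (φ.symm w) :=
    D.proj_eq_iff.1 (hp.apply_localInverseAt_of_mem hwv)
  obtain ⟨F, hF, hFγ⟩ := D.exists_contDiff γ.2
  refine hF.contDiffAt.contDiffWithinAt.congr_of_eventuallyEq_of_mem ?_ hw
  refine Filter.Eventually.filter_mono nhdsWithin_le_nhds ?_
  have c1 : ContinuousAt φ.symm w := φ.continuousAt_symm hwφ
  have e1 : ∀ᶠ w' in 𝓝 w, w' ∈ φ.target := φ.open_target.mem_nhds hwφ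
  have e2 : ∀ᶠ w' in 𝓝 w, D.proj (φ.symm w') ∈ Lv.source :=
    (hp.continuous.continuousAt.comp c1).eventually (Lv.open_source.mem_nhds hwv)
  have e3 : ∀ᶠ w' in 𝓝 w, γ • φ.symm w' ∈ Lv.target := by
    refine (c1.const_smul γ).eventually (Lv.open_target.mem_nhds ?_)
    change γ • φ.symm w ∈ Lv.target
    rw [show γ • φ.symm w = _ from hγ]
    exact Lv.map_source hwv
  filter_upwards [e1, e2, e3] with w' h1 h2 h3
  have key : Lv (D.proj (φ.symm w')) = γ • φ.symm w' := by
    refine hp.injOn_localInverseAt_target (Lv.map_source h2) h3 ?_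
    rw [hp.apply_localInverseAt_of_mem h2, D.isQuotientCoveringMap_proj.map_smul]
  have : F w' = ψ (γ • φ.symm w') := by
    conv_lhs => rw [← hφ w' h1, hFγ]
    rfl
  rw [this, ← key, ← hLu]
  rfl

/-- The model of the complex surfaces `S⁺`: their charts take values in `ℂ × ℂ`. -/
abbrev model : ModelWithCorners ℂ (ℂ × ℂ) (ModelProd ℂ ℂ) := 𝓘(ℂ, ℂ).prod 𝓘(ℂ, ℂ)

/-- The equivalence relation generated by deformation equivalence of the Inoue surfaces of
type `S⁺` with the given parameters. -/
def deformationSetoid : Setoid SPlusData :=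
  Relation.EqvGen.setoid fun D₁ D₂ => DeformationEquivalent model model D₁.Surface D₂.Surface

end SPlusData

end

/-!
The elements of `G⁺` are maps `(w, z) ↦ (α ^ k w + A, z + B w + C)`, where `k : G⁺ → ℤ` is a
homomorphism, and `A` and `B` are additive on its kernel. As a power of `g₃` is the commutator of `g₁`
and `g₂`, the real-valued additive functions on the kernel are exactly the combinations of `A` and
`B` (`SPlusData.AdditiveOnKer.exists_eq`), and conjugation by `g₀` multiplies `A` by `α` and `B` by
`1 / α`.

A homotopy equivalence of the surfaces gives an isomorphism `φ` of the groups, which are their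
fundamental groups. Since no nonzero additive function on the kernel of `k` is invariant under
conjugation by `g₀`, `φ` respects the kernels, so it multiplies `k` by a sign `ε`. Comparing
eigenvalues, it pulls `A` (if `ε = 1`) or `B` (if `ε = -1`) back to `l A` for some real `l ≠ 0`
(`SPlusData.exists_signedTr_map_eq`). The pair `(ε, sign l)` sorts the surfaces into families, and two
members of one family have groups with an isomorphism `φ` for which `ε = 1` and `l > 0`.

Such a `φ` is almost induced by an automorphism of `ℍ × ℂ` (`SPlusData.exists_intertwining`): the
difference of the `C`-parts of the two actions of the kernel of `k` is additive, so it is a combination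
of `A` and `B`, and it is removed by an affine automorphism `T : (w, z) ↦ (l w + σ, μ z + β w)`.
Here `l > 0` is needed for `T` to preserve the upper half plane. After conjugation by `T`, the two
images of `g₀` differ by a map that commutes with the kernel, that is, a translation of `z`.

It remains to change the parameter `t`. Let `γ ∈ G⁺` act on `(ℍ × ℂ) × ℂ` by
`(x, s) ↦ (γ x + (0, k(γ) s), s)`. Since `γ` adds `k(γ)` to `log (im w) / log α`, the quotient is
homeomorphic, over the base `ℂ`, to the product of the surface with `ℂ`. Hence its total space is taken
to be that product (`SPlusData.Family`), with the complex structure for which the quotient map is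
locally biholomorphic; properness of the projection is then the compactness of the surface.
-/

noncomputable section

/-! ### The normal form of the elements of the group -/

namespace SPlusData

variable (D : SPlusData)

lemma exists_coords (γ : D.group) : ∃ v : ℤ × ℤ × ℤ × ℤ, ∀ x : ℍ × ℂ,
      ((γ • x).1 : ℂ) = ((D.α ^ v.1 : ℝ) : ℂ) * (x.1 + (v.2.1 * D.a 0 + v.2.2.1 * D.a 1 : ℝ)) ∧
      (γ • x).2 = x.2 + (v.2.1 * D.b 0 + v.2.2.1 * D.b 1 : ℝ) * x.1 + v.1 * D.t +
        (v.2.1 * (D.c 0 - D.a 0 * D.b 0 / 2) + v.2.2.1 * (D.c 1 - D.a 1 * D.b 1 / 2)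
          + 1 / 2 * (v.2.1 * D.a 0 + v.2.2.1 * D.a 1) * (v.2.1 * D.b 0 + v.2.2.1 * D.b 1)
          + v.2.2.2 * (D.θ / (2 * D.r)) : ℝ) := by
  obtain ⟨k, m, n, y, h⟩ := D.group_form γ.2
  exact ⟨(k, m, n, y), h⟩

/-- Integers `(k, m, n, y)` that describe an element of `G⁺` as in `SPlusData.group_form`. -/
def coords (γ : D.group) : ℤ × ℤ × ℤ × ℤ := (D.exists_coords γ).choose

/-- The integer `k` such that `γ` acts on imaginary parts in `ℍ` as multiplication by `α ^ k`. -/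
def deg (γ : D.group) : ℤ := (D.coords γ).1

/-- The real number `A` such that `γ` acts on `ℍ` as `w ↦ α ^ k w + A`. -/
def trA (γ : D.group) : ℝ :=
  D.α ^ D.deg γ * ((D.coords γ).2.1 * D.a 0 + (D.coords γ).2.2.1 * D.a 1)

/-- The real number `B` such that `γ` acts on the second coordinate as `z ↦ z + B w + C`. -/
def slope (γ : D.group) : ℝ := (D.coords γ).2.1 * D.b 0 + (D.coords γ).2.2.1 * D.b 1

/-- The complex number `C` such that `γ` acts on the second coordinate as `z ↦ z + B w + C`. -/
def trC (γ : D.group) : ℂ :=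
  D.deg γ * D.t +
    ((D.coords γ).2.1 * (D.c 0 - D.a 0 * D.b 0 / 2)
      + (D.coords γ).2.2.1 * (D.c 1 - D.a 1 * D.b 1 / 2)
      + 1 / 2 * ((D.coords γ).2.1 * D.a 0 + (D.coords γ).2.2.1 * D.a 1)
        * ((D.coords γ).2.1 * D.b 0 + (D.coords γ).2.2.1 * D.b 1)
      + (D.coords γ).2.2.2 * (D.θ / (2 * D.r)) : ℝ)

lemma coe_smul_fst (γ : D.group) (x : ℍ × ℂ) :
    ((γ • x).1 : ℂ) = ((D.α ^ D.deg γ : ℝ) : ℂ) * x.1 + (D.trA γ : ℂ) := by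
  rw [((D.exists_coords γ).choose_spec x).1, trA, deg, coords]
  push_cast
  ring

lemma smul_snd (γ : D.group) (x : ℍ × ℂ) :
    (γ • x).2 = x.2 + (D.slope γ : ℂ) * x.1 + D.trC γ := by
  rw [((D.exists_coords γ).choose_spec x).2, slope, trC, deg, coords]
  ring

lemma im_smul_fst (γ : D.group) (x : ℍ × ℂ) : (γ • x).1.im = D.α ^ D.deg γ * x.1.im := by
  have := congrArg Complex.im (D.coe_smul_fst γ x)
  rwa [Complex.add_im, Complex.im_ofReal_mul, Complex.ofReal_im, add_zero] at this

lemma re_smul_fst (γ : D.group) (x : ℍ × ℂ) :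
    (γ • x).1.re = D.α ^ D.deg γ * x.1.re + D.trA γ := by
  have := congrArg Complex.re (D.coe_smul_fst γ x)
  rwa [Complex.add_re, Complex.re_ofReal_mul, Complex.ofReal_re] at this

lemma zpow_α_pos (k : ℤ) : 0 < D.α ^ k := zpow_pos D.α_pos k

lemma zpow_α_injective : Function.Injective fun k : ℤ => D.α ^ k :=
  zpow_right_injective₀ D.α_pos D.one_lt_α.ne'

variable {D}

/-- The numbers `k, A, B, C` are determined by the action of `γ`. -/
lemma eq_of_forall_smul {γ : D.group} {k : ℤ} {A B : ℝ} {C : ℂ}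
    (h : ∀ x : ℍ × ℂ, ((γ • x).1 : ℂ) = ((D.α ^ k : ℝ) : ℂ) * x.1 + A ∧
      (γ • x).2 = x.2 + (B : ℂ) * x.1 + C) :
    D.deg γ = k ∧ D.trA γ = A ∧ D.slope γ = B ∧ D.trC γ = C := by
  have h1 := h (UpperHalfPlane.I, 0)
  have h2 := (h (⟨2 * Complex.I, by simp⟩, 0)).2
  rw [D.coe_smul_fst, D.smul_snd] at h1
  rw [D.smul_snd] at h2
  simp only [UpperHalfPlane.coe_I, zero_add] at h1 h2
  have e1 := congrArg Complex.im h1.1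
  have e2 := congrArg Complex.re h1.1
  rw [Complex.add_im, Complex.add_im, Complex.im_ofReal_mul, Complex.im_ofReal_mul] at e1
  rw [Complex.add_re, Complex.add_re, Complex.re_ofReal_mul, Complex.re_ofReal_mul] at e2
  simp only [Complex.I_im, Complex.I_re, Complex.ofReal_im, Complex.ofReal_re, mul_one, mul_zero,
    add_zero, zero_add] at e1 e2
  have e3 : (D.slope γ : ℂ) * Complex.I = B * Complex.I := by
    linear_combination h2 - h1.2
  have e4 := mul_right_cancel₀ Complex.I_ne_zero e3
  refine ⟨D.zpow_α_injective e1, e2, Complex.ofReal_injective e4, ?_⟩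
  linear_combination h1.2 - e3

lemma group_ext {γ δ : D.group} (h1 : D.deg γ = D.deg δ) (h2 : D.trA γ = D.trA δ)
    (h3 : D.slope γ = D.slope δ) (h4 : D.trC γ = D.trC δ) : γ = δ := by
  apply Subtype.ext
  apply Homeomorph.ext
  intro x
  change γ • x = δ • x
  refine Prod.ext (UpperHalfPlane.ext ?_) ?_
  · rw [D.coe_smul_fst, D.coe_smul_fst, h1, h2]
  · rw [D.smul_snd, D.smul_snd, h3, h4]

lemma mul_form (γ δ : D.group) :
    D.deg (γ * δ) = D.deg γ + D.deg δ ∧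
    D.trA (γ * δ) = D.α ^ D.deg γ * D.trA δ + D.trA γ ∧
    D.slope (γ * δ) = D.slope δ + D.slope γ * D.α ^ D.deg δ ∧
    D.trC (γ * δ) = D.trC δ + D.slope γ * D.trA δ + D.trC γ := by
  refine eq_of_forall_smul fun x => ⟨?_, ?_⟩
  · rw [mul_smul, D.coe_smul_fst, D.coe_smul_fst, zpow_add₀ D.α_pos.ne']
    push_cast
    ring
  · rw [mul_smul, D.smul_snd, D.smul_snd, D.coe_smul_fst]
    push_cast
    ring

lemma deg_mul (γ δ : D.group) : D.deg (γ * δ) = D.deg γ + D.deg δ := (mul_form γ δ).1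

lemma trA_mul (γ δ : D.group) :
    D.trA (γ * δ) = D.α ^ D.deg γ * D.trA δ + D.trA γ := (mul_form γ δ).2.1

lemma slope_mul (γ δ : D.group) :
    D.slope (γ * δ) = D.slope δ + D.slope γ * D.α ^ D.deg δ := (mul_form γ δ).2.2.1

lemma trC_mul (γ δ : D.group) :
    D.trC (γ * δ) = D.trC δ + D.slope γ * D.trA δ + D.trC γ := (mul_form γ δ).2.2.2

variable (D)

/-- The homomorphism `deg : G⁺ → ℤ`, with multiplicative notation for `ℤ`. -/
def degHom : D.group →* Multiplicative ℤ :=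
  MonoidHom.mk' (fun γ => Multiplicative.ofAdd (D.deg γ)) fun γ δ => by
    rw [deg_mul, ofAdd_add]

lemma deg_one : D.deg 1 = 0 := Multiplicative.ofAdd.injective (map_one D.degHom)

lemma deg_inv (γ : D.group) : D.deg γ⁻¹ = -D.deg γ :=
  Multiplicative.ofAdd.injective (map_inv D.degHom γ)

lemma deg_zpow (γ : D.group) (n : ℤ) : D.deg (γ ^ n) = n * D.deg γ := by
  have := Multiplicative.ofAdd.injective ((map_zpow D.degHom γ n).trans (ofAdd_zsmul n _).symm)
  simpa using this

lemma trC_im_of_deg_eq_zero {γ : D.group} (h : D.deg γ = 0) : (D.trC γ).im = 0 := by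
  simp [trC, h, -Complex.ofReal_add, -Complex.ofReal_mul]

/-- The generator `g₀` as an element of `G⁺`. -/
def s₀ : D.group := ⟨D.g₀, Subgroup.subset_closure (by simp)⟩

/-- The generators `g₁, g₂` as elements of `G⁺`. -/
def s (i : Fin 2) : D.group := ⟨D.g i, Subgroup.subset_closure (by fin_cases i <;> simp)⟩

/-- The generator `g₃` as an element of `G⁺`. -/
def s₃ : D.group := ⟨D.g₃, Subgroup.subset_closure (by simp)⟩

lemma s₀_form : D.deg D.s₀ = 1 ∧ D.trA D.s₀ = 0 ∧ D.slope D.s₀ = 0 ∧ D.trC D.s₀ = D.t := by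
  refine eq_of_forall_smul fun x => ?_
  rw [smul_def, s₀, g₀_apply]
  simp [UpperHalfPlane.coe_pos_real_smul]

lemma s_form (i : Fin 2) : D.deg (D.s i) = 0 ∧ D.trA (D.s i) = D.a i ∧
    D.slope (D.s i) = D.b i ∧ D.trC (D.s i) = D.c i := by
  refine eq_of_forall_smul fun x => ?_
  rw [smul_def, s, g_apply]
  simp [UpperHalfPlane.coe_vadd, add_comm]

lemma s₃_form : D.deg D.s₃ = 0 ∧ D.trA D.s₃ = 0 ∧
    D.slope D.s₃ = 0 ∧ D.trC D.s₃ = ((-(D.θ / D.r) : ℝ) : ℂ) := by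
  refine eq_of_forall_smul fun x => ?_
  rw [smul_def, s₃, g₃_apply]
  simp [sub_eq_add_neg]

end SPlusData

/-! ### Compactness and separation of the surfaces -/

lemma map_zpow_of_additive {G R : Type*} [Group G] [Ring R] {χ : G → R} {γ : G}
    (h : ∀ m n : ℤ, χ (γ ^ (m + n)) = χ (γ ^ m) + χ (γ ^ n)) (n : ℤ) :
    χ (γ ^ n) = n * χ γ := by
  have := map_zsmul (AddMonoidHom.mk' (fun n : ℤ => χ (γ ^ n)) h) n 1
  simpa using this

namespace SPlusData

variable (D : SPlusData)

/-- `χ` is additive on the kernel of `deg`, the subgroup generated by `g₁, g₂, g₃`. -/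
def AdditiveOnKer (χ : D.group → ℝ) : Prop :=
  ∀ γ δ : D.group, D.deg γ = 0 → D.deg δ = 0 → χ (γ * δ) = χ γ + χ δ

variable {D}

lemma deg_zpow_eq_zero {γ : D.group} (h : D.deg γ = 0) (n : ℤ) : D.deg (γ ^ n) = 0 := by
  rw [deg_zpow, h, mul_zero]

lemma AdditiveOnKer.map_zpow {χ : D.group → ℝ} (hχ : D.AdditiveOnKer χ) {γ : D.group}
    (h : D.deg γ = 0) (n : ℤ) : χ (γ ^ n) = n * χ γ :=
  map_zpow_of_additive (fun m n => by
    rw [zpow_add, hχ _ _ (deg_zpow_eq_zero h m) (deg_zpow_eq_zero h n)]) n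

variable (D)

lemma additiveOnKer_trA : D.AdditiveOnKer D.trA := fun γ δ h _ => by
  rw [trA_mul, h, zpow_zero, one_mul, add_comm]

lemma additiveOnKer_slope : D.AdditiveOnKer D.slope := fun γ δ _ h => by
  rw [slope_mul, h, zpow_zero, mul_one, add_comm]

lemma s_zpow_mul_s_zpow_form (m n : ℤ) :
    D.deg (D.s 0 ^ m * D.s 1 ^ n) = 0 ∧
    D.trA (D.s 0 ^ m * D.s 1 ^ n) = m * D.a 0 + n * D.a 1 ∧
    D.slope (D.s 0 ^ m * D.s 1 ^ n) = m * D.b 0 + n * D.b 1 := by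
  obtain ⟨h0, a0, b0, -⟩ := D.s_form 0
  obtain ⟨h1, a1, b1, -⟩ := D.s_form 1
  have k0 := deg_zpow_eq_zero h0 m
  have k1 := deg_zpow_eq_zero h1 n
  refine ⟨by rw [deg_mul, k0, k1, add_zero], ?_, ?_⟩
  · rw [D.additiveOnKer_trA _ _ k0 k1, D.additiveOnKer_trA.map_zpow h0,
      D.additiveOnKer_trA.map_zpow h1, a0, a1]
  · rw [D.additiveOnKer_slope _ _ k0 k1, D.additiveOnKer_slope.map_zpow h0,
      D.additiveOnKer_slope.map_zpow h1, b0, b1]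

lemma s₃_zpow_form (l : ℤ) : D.deg (D.s₃ ^ l) = 0 ∧ D.trA (D.s₃ ^ l) = 0 ∧
    D.slope (D.s₃ ^ l) = 0 ∧ D.trC (D.s₃ ^ l) = ((-(l * (D.θ / D.r)) : ℝ) : ℂ) := by
  obtain ⟨h, hA, hB, hC⟩ := D.s₃_form
  have hB' (n : ℤ) : D.slope (D.s₃ ^ n) = 0 := by
    rw [D.additiveOnKer_slope.map_zpow h, hB, mul_zero]
  refine ⟨deg_zpow_eq_zero h l, ?_, hB' l, ?_⟩
  · rw [D.additiveOnKer_trA.map_zpow h, hA, mul_zero]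
  · rw [map_zpow_of_additive (χ := D.trC) (γ := D.s₃), hC]
    · push_cast; ring
    · intro m n
      rw [zpow_add, trC_mul, hB' m]
      push_cast
      ring

/-- Every point of the plane can be moved into a fixed box by a lattice with basis `(a₀, b₀)`,
`(a₁, b₁)`. -/
lemma exists_round (a₀ a₁ b₀ b₁ u v : ℝ) (h : a₀ * b₁ - a₁ * b₀ ≠ 0) :
    ∃ m n : ℤ, |u + (m * a₀ + n * a₁)| ≤ |a₀| + |a₁| ∧ |v + (m * b₀ + n * b₁)| ≤ |b₀| + |b₁| := by
  -- round the real solution `(μ, ν)` of `u + μ a₀ + ν a₁ = 0 = v + μ b₀ + ν b₁`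
  set μ := (a₁ * v - b₁ * u) / (a₀ * b₁ - a₁ * b₀)
  set ν := (b₀ * u - a₀ * v) / (a₀ * b₁ - a₁ * b₀)
  have hμ' : μ * (a₀ * b₁ - a₁ * b₀) = a₁ * v - b₁ * u := div_mul_cancel₀ _ h
  have hν' : ν * (a₀ * b₁ - a₁ * b₀) = b₀ * u - a₀ * v := div_mul_cancel₀ _ h
  clear_value μ ν
  have hu : u = -(μ * a₀ + ν * a₁) :=
    mul_right_cancel₀ h (by linear_combination a₀ * hμ' + a₁ * hν')
  have hv : v = -(μ * b₀ + ν * b₁) :=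
    mul_right_cancel₀ h (by linear_combination b₀ * hμ' + b₁ * hν')
  have h1 : |Int.fract μ| ≤ 1 := by
    rw [abs_of_nonneg (Int.fract_nonneg _)]; exact (Int.fract_lt_one _).le
  have h2 : |Int.fract ν| ≤ 1 := by
    rw [abs_of_nonneg (Int.fract_nonneg _)]; exact (Int.fract_lt_one _).le
  have key (c d : ℝ) : |-(μ * c + ν * d) + (⌊μ⌋ * c + ⌊ν⌋ * d)| ≤ |c| + |d| := by
    have : -(μ * c + ν * d) + (⌊μ⌋ * c + ⌊ν⌋ * d) = -(Int.fract μ * c + Int.fract ν * d) := by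
      rw [← Int.self_sub_floor, ← Int.self_sub_floor]; ring
    rw [this, abs_neg]
    refine (abs_add_le _ _).trans ?_
    rw [abs_mul, abs_mul]
    exact add_le_add (mul_le_of_le_one_left (abs_nonneg _) h1)
      (mul_le_of_le_one_left (abs_nonneg _) h2)
  exact ⟨⌊μ⌋, ⌊ν⌋, by rw [hu]; exact key _ _, by rw [hv]; exact key _ _⟩

/-- A compact subset of `ℍ × ℂ` that meets every orbit of `G⁺`. -/
def fundamentalBox : Set (ℍ × ℂ) :=
  {x | (x.1.re ∈ Set.Icc (-(|D.a 0| + |D.a 1|)) (|D.a 0| + |D.a 1|) ∧ x.1.im ∈ Set.Icc 1 D.α) ∧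
    x.2.re ∈ Set.Icc (-|D.θ / D.r|) |D.θ / D.r| ∧
    x.2.im ∈ Set.Icc (-(D.α * (|D.b 0| + |D.b 1|))) (D.α * (|D.b 0| + |D.b 1|))}

lemma isCompact_fundamentalBox : IsCompact D.fundamentalBox := by
  have h1 : IsCompact {w : ℍ | w.re ∈ Set.Icc (-(|D.a 0| + |D.a 1|)) (|D.a 0| + |D.a 1|) ∧
      w.im ∈ Set.Icc 1 D.α} := by
    rw [UpperHalfPlane.isEmbedding_coe.isInducing.isCompact_iff]
    convert (isCompact_Icc (a := -(|D.a 0| + |D.a 1|)) (b := |D.a 0| + |D.a 1|)).reProdIm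
      (isCompact_Icc (a := 1) (b := D.α)) using 1
    ext w
    constructor
    · rintro ⟨w, h, rfl⟩
      exact h
    · intro h
      exact ⟨⟨w, one_pos.trans_le h.2.1⟩, h, rfl⟩
  exact h1.prod (isCompact_Icc.reProdIm isCompact_Icc)

lemma exists_smul_mem_fundamentalBox (x : ℍ × ℂ) : ∃ γ : D.group, γ • x ∈ D.fundamentalBox := by
  have hα := D.α_pos
  obtain ⟨k, hk⟩ := exists_mem_Ico_zpow x.1.im_pos D.one_lt_α
  set x₁ := D.s₀ ^ (-k) • x with hx₁
  have him₁ : x₁.1.im ∈ Set.Icc 1 D.α := by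
    rw [hx₁, im_smul_fst, deg_zpow, D.s₀_form.1, mul_one, zpow_neg, inv_mul_eq_div]
    constructor
    · rw [le_div_iff₀ (D.zpow_α_pos k), one_mul]
      exact hk.1
    · rw [div_le_iff₀ (D.zpow_α_pos k), mul_comm, ← zpow_add_one₀ hα.ne']
      exact hk.2.le
  obtain ⟨m, n, h1, h2⟩ := exists_round (D.a 0) (D.a 1) (D.b 0) (D.b 1) x₁.1.re
    (x₁.2.im / x₁.1.im) D.θ_ne_zero
  obtain ⟨f1, f2, f3⟩ := D.s_zpow_mul_s_zpow_form m n
  set γ := D.s 0 ^ m * D.s 1 ^ n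
  set x₂ := γ • x₁ with hx₂
  have him₂ : x₂.1.im = x₁.1.im := by rw [hx₂, im_smul_fst, f1, zpow_zero, one_mul]
  have hre₂ : x₂.1.re = x₁.1.re + (m * D.a 0 + n * D.a 1) := by
    rw [hx₂, re_smul_fst, f1, zpow_zero, one_mul, f2]
  have hz₂ : x₂.2.im = (x₁.2.im / x₁.1.im + (m * D.b 0 + n * D.b 1)) * x₁.1.im := by
    rw [hx₂, smul_snd, Complex.add_im, Complex.add_im, D.trC_im_of_deg_eq_zero f1, f3,
      Complex.im_ofReal_mul, UpperHalfPlane.coe_im, add_mul (x₁.2.im / _),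
      div_mul_cancel₀ _ x₁.1.im_ne_zero, add_zero]
  have hr : D.θ / D.r ≠ 0 := div_ne_zero D.θ_ne_zero (Int.cast_ne_zero.2 D.r_ne_zero)
  set l := ⌊x₂.2.re / (D.θ / D.r)⌋ with hl
  obtain ⟨l1, l2, l3, l4⟩ := D.s₃_zpow_form l
  refine ⟨D.s₃ ^ l * (γ * D.s₀ ^ (-k)), ?_⟩
  rw [mul_smul, mul_smul, ← hx₁, ← hx₂]
  refine ⟨⟨?_, ?_⟩, ?_, ?_⟩
  · rw [re_smul_fst, l1, l2, zpow_zero, one_mul, add_zero, hre₂]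
    exact abs_le.1 h1
  · rw [im_smul_fst, l1, zpow_zero, one_mul, him₂]
    exact him₁
  · rw [smul_snd, l3, l4, Complex.add_re, Complex.add_re, Complex.ofReal_re, Complex.ofReal_zero,
      zero_mul, Complex.zero_re, add_zero, ← sub_eq_add_neg]
    have : x₂.2.re - l * (D.θ / D.r) = Int.fract (x₂.2.re / (D.θ / D.r)) * (D.θ / D.r) := by
      rw [← Int.self_sub_floor, ← hl, sub_mul, div_mul_cancel₀ _ hr]
    rw [this]
    apply abs_le.1
    rw [abs_mul, abs_of_nonneg (Int.fract_nonneg _)]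
    exact mul_le_of_le_one_left (abs_nonneg _) (Int.fract_lt_one _).le
  · rw [smul_snd, l3, l4, Complex.add_im, Complex.add_im, Complex.ofReal_im, Complex.ofReal_zero,
      zero_mul, Complex.zero_im, add_zero, add_zero, hz₂]
    apply abs_le.1
    rw [abs_mul, abs_of_pos x₁.1.im_pos, mul_comm]
    exact mul_le_mul him₁.2 h2 (abs_nonneg _) hα.le

lemma continuous_proj : Continuous D.proj := D.isLocalHomeomorph_proj.continuous

lemma surjective_proj : Function.Surjective D.proj := D.isQuotientCoveringMap_proj.surjective

lemma proj_smul (γ : D.group) (x : ℍ × ℂ) : D.proj (γ • x) = D.proj x :=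
  D.isQuotientCoveringMap_proj.map_smul γ

instance : CompactSpace D.Surface := by
  refine ⟨?_⟩
  convert D.isCompact_fundamentalBox.image D.continuous_proj
  refine (Set.eq_univ_of_forall fun x => ?_).symm
  obtain ⟨y, rfl⟩ := D.surjective_proj x
  obtain ⟨γ, hγ⟩ := D.exists_smul_mem_fundamentalBox y
  exact ⟨_, hγ, D.proj_smul γ y⟩

instance : PathConnectedSpace D.Surface :=
  D.surjective_proj.pathConnectedSpace D.continuous_proj

instance : SecondCountableTopology D.Surface :=
  ContinuousConstSMul.secondCountableTopology (Γ := D.group) (T := ℍ × ℂ)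

lemma coords_injective : Function.Injective D.coords := by
  intro γ δ h
  have h1 : D.deg γ = D.deg δ := by rw [deg, deg, h]
  apply group_ext h1
  · rw [trA, trA, h, h1]
  · rw [slope, slope, h]
  · rw [trC, trC, h, h1]

/-- Real numbers computed from `x` and `x'` that are the coordinates of `γ` if `x' = γ • x`. -/
def coordsOf (u : (ℍ × ℂ) × (ℍ × ℂ)) : ℝ × ℝ × ℝ × ℝ :=
  let k : ℝ := Real.log (u.2.1.im / u.1.1.im) / Real.log D.α
  let A : ℝ := u.1.1.im / u.2.1.im * u.2.1.re - u.1.1.re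
  let B : ℝ := (u.2.2.im - u.1.2.im - k * D.t.im) / u.1.1.im
  let m : ℝ := (D.b 1 * A - D.a 1 * B) / D.θ
  let n : ℝ := (D.a 0 * B - D.b 0 * A) / D.θ
  (k, m, n, (u.2.2.re - u.1.2.re - B * u.1.1.re - k * D.t.re
    - (m * (D.c 0 - D.a 0 * D.b 0 / 2) + n * (D.c 1 - D.a 1 * D.b 1 / 2) + 1 / 2 * A * B))
      / (D.θ / (2 * D.r)))

lemma continuous_coordsOf : Continuous D.coordsOf := by
  have him := UpperHalfPlane.continuous_im
  have hre := UpperHalfPlane.continuous_re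
  have h1 (u : (ℍ × ℂ) × (ℍ × ℂ)) : u.1.1.im ≠ 0 := u.1.1.im_ne_zero
  have h2 (u : (ℍ × ℂ) × (ℍ × ℂ)) : u.2.1.im ≠ 0 := u.2.1.im_ne_zero
  have h3 (u : (ℍ × ℂ) × (ℍ × ℂ)) : u.2.1.im / u.1.1.im ≠ 0 := div_ne_zero (h2 u) (h1 u)
  change Continuous fun u => D.coordsOf u
  simp only [coordsOf]
  fun_prop (disch := assumption)

lemma coordsOf_smul (γ : D.group) (x : ℍ × ℂ) :
    D.coordsOf (x, γ • x) =
      (((D.coords γ).1 : ℝ), ((D.coords γ).2.1 : ℝ), ((D.coords γ).2.2.1 : ℝ),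
        ((D.coords γ).2.2.2 : ℝ)) := by
  have hα := D.α_pos
  have hθ := D.θ_ne_zero
  have hr : (D.r : ℝ) ≠ 0 := Int.cast_ne_zero.2 D.r_ne_zero
  have hx := x.1.im_ne_zero
  have hk := (D.zpow_α_pos (D.deg γ)).ne'
  have hk1 : Real.log ((γ • x).1.im / x.1.im) / Real.log D.α = (D.coords γ).1 := by
    rw [im_smul_fst, mul_div_cancel_right₀ _ hx, Real.log_zpow,
      mul_div_cancel_right₀ _ (Real.log_pos D.one_lt_α).ne', deg]
  have hA : x.1.im / (γ • x).1.im * (γ • x).1.re - x.1.re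
      = (D.coords γ).2.1 * D.a 0 + (D.coords γ).2.2.1 * D.a 1 := by
    rw [im_smul_fst, re_smul_fst, trA]
    field_simp
    ring
  have hC : D.trC γ = D.deg γ * D.t + _ := rfl
  have hz := congrArg Complex.im (D.smul_snd γ x)
  rw [hC, Complex.add_im, Complex.add_im, Complex.im_ofReal_mul, Complex.add_im,
    Complex.ofReal_im, add_zero, show (D.deg γ : ℂ) = ((D.deg γ : ℝ) : ℂ) by simp,
    Complex.im_ofReal_mul, UpperHalfPlane.coe_im] at hz
  have hB : ((γ • x).2.im - x.2.im - (D.coords γ).1 * D.t.im) / x.1.im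
      = (D.coords γ).2.1 * D.b 0 + (D.coords γ).2.2.1 * D.b 1 := by
    rw [div_eq_iff hx, hz, slope, deg]
    ring
  have hw := congrArg Complex.re (D.smul_snd γ x)
  rw [hC, Complex.add_re, Complex.add_re, Complex.re_ofReal_mul, Complex.add_re,
    Complex.ofReal_re, show (D.deg γ : ℂ) = ((D.deg γ : ℝ) : ℂ) by simp,
    Complex.re_ofReal_mul, UpperHalfPlane.coe_re] at hw
  have hm : (D.b 1 * ((D.coords γ).2.1 * D.a 0 + (D.coords γ).2.2.1 * D.a 1)
      - D.a 1 * ((D.coords γ).2.1 * D.b 0 + (D.coords γ).2.2.1 * D.b 1)) / D.θ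
      = (D.coords γ).2.1 := by
    rw [div_eq_iff hθ, θ]; ring
  have hn : (D.a 0 * ((D.coords γ).2.1 * D.b 0 + (D.coords γ).2.2.1 * D.b 1)
      - D.b 0 * ((D.coords γ).2.1 * D.a 0 + (D.coords γ).2.2.1 * D.a 1)) / D.θ
      = (D.coords γ).2.2.1 := by
    rw [div_eq_iff hθ, θ]; ring
  simp only [coordsOf, hk1, hA, hB, hm, hn]
  refine Prod.ext rfl (Prod.ext rfl (Prod.ext rfl ?_))
  change _ / _ = _
  rw [div_eq_iff (by positivity), hw, slope, deg]
  ring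

/-- For compact sets `K` and `L`, the coordinates of the elements of `G⁺` that move a point of `K`
into `L` are integers that lie in the compact set `D.coordsOf '' (K × L)`. -/
instance : ProperlyDiscontinuousSMul D.group (ℍ × ℂ) where
  finite_disjoint_inter_image {K L} hK hL := by
    let ι : ℤ × ℤ × ℤ × ℤ → ℝ × ℝ × ℝ × ℝ :=
      Prod.map (↑) (Prod.map (↑) (Prod.map (↑) (↑)))
    have hι : Topology.IsClosedEmbedding ι := Int.isClosedEmbedding_coe_real.prodMap
      (Int.isClosedEmbedding_coe_real.prodMap
        (Int.isClosedEmbedding_coe_real.prodMap Int.isClosedEmbedding_coe_real))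
    have hfin : (ι ⁻¹' (D.coordsOf '' (K ×ˢ L))).Finite :=
      (hι.isCompact_preimage ((hK.prod hL).image D.continuous_coordsOf)).finite_of_discrete
    refine (hfin.preimage D.coords_injective.injOn).subset ?_
    rintro γ hγ
    obtain ⟨_, ⟨x, hx, rfl⟩, hx'⟩ := hγ
    exact ⟨(x, γ • x), ⟨hx, hx'⟩, D.coordsOf_smul γ x⟩

instance : T2Space D.Surface :=
  inferInstanceAs (T2Space (Quotient (MulAction.orbitRel D.group (ℍ × ℂ))))

end SPlusData

/-! ### Additive functions and isomorphisms of the groups -/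

namespace SPlusData

section Ker

variable {D : SPlusData}

lemma eq_zero_of_forall_combination {l m : ℝ}
    (h : ∀ γ : D.group, D.deg γ = 0 → l * D.trA γ + m * D.slope γ = 0) : l = 0 ∧ m = 0 := by
  obtain ⟨h0, a0, b0, -⟩ := D.s_form 0
  obtain ⟨h1, a1, b1, -⟩ := D.s_form 1
  have e0 := h _ h0
  have e1 := h _ h1
  rw [a0, b0] at e0
  rw [a1, b1] at e1
  have hθ := D.θ_ne_zero
  exact ⟨(mul_eq_zero.1 (by unfold θ; linear_combination D.b 1 * e0 - D.b 0 * e1 :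
      l * D.θ = 0)).resolve_right hθ,
    (mul_eq_zero.1 (by unfold θ; linear_combination D.a 0 * e1 - D.a 1 * e0 :
      m * D.θ = 0)).resolve_right hθ⟩

lemma exists_trA_ne_zero : ∃ γ : D.group, D.deg γ = 0 ∧ D.trA γ ≠ 0 := by
  by_contra! h
  exact one_ne_zero (eq_zero_of_forall_combination (D := D) (l := 1) (m := 0)
    fun γ hγ => by rw [h γ hγ, mul_zero, zero_mul, add_zero]).1

lemma exists_slope_ne_zero : ∃ γ : D.group, D.deg γ = 0 ∧ D.slope γ ≠ 0 := by
  by_contra! h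
  exact one_ne_zero (eq_zero_of_forall_combination (D := D) (l := 0) (m := 1)
    fun γ hγ => by rw [h γ hγ, mul_zero, zero_mul, add_zero]).2

lemma deg_conj (g γ : D.group) : D.deg (g * γ * g⁻¹) = D.deg γ := by
  rw [deg_mul, deg_mul, deg_inv]
  ring

lemma trA_conj (g : D.group) {γ : D.group} (h : D.deg γ = 0) :
    D.trA (g * γ * g⁻¹) = D.α ^ D.deg g * D.trA γ := by
  have e := congrArg D.trA (inv_mul_cancel_right (g * γ) g)
  rw [trA_mul, trA_mul g γ, deg_conj, h, zpow_zero] at e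
  linear_combination e

lemma slope_conj (g : D.group) {γ : D.group} (h : D.deg γ = 0) :
    D.slope (g * γ * g⁻¹) = D.α ^ (-D.deg g) * D.slope γ := by
  have e := congrArg D.slope (inv_mul_cancel_right (g * γ) g)
  rw [slope_mul, slope_mul g γ, h, zpow_zero] at e
  rw [zpow_neg, eq_inv_mul_iff_mul_eq₀ (D.zpow_α_pos _).ne']
  linear_combination e

/-- The square of an element acting as a translation of the second coordinate is a power of `g₃`:
`SPlusData.group_form` provides the length of the translation as a multiple of half that of `g₃`. -/
lemma exists_sq_eq_s₃_zpow {ζ : D.group} (h : D.deg ζ = 0) (hA : D.trA ζ = 0)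
    (hB : D.slope ζ = 0) : ∃ y : ℤ, ζ * ζ = D.s₃ ^ y := by
  have hθ := D.θ_ne_zero
  have hr : (D.r : ℝ) ≠ 0 := Int.cast_ne_zero.2 D.r_ne_zero
  set m := (D.coords ζ).2.1 with hm
  set n := (D.coords ζ).2.2.1 with hn
  have eA : (m : ℝ) * D.a 0 + n * D.a 1 = 0 := by
    rw [trA, h, zpow_zero, one_mul] at hA
    exact hA
  have eB : (m : ℝ) * D.b 0 + n * D.b 1 = 0 := hB
  have hm0 : (m : ℝ) = 0 :=
    mul_right_cancel₀ hθ (by unfold θ; linear_combination D.b 1 * eA - D.a 1 * eB)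
  have hn0 : (n : ℝ) = 0 :=
    mul_right_cancel₀ hθ (by unfold θ; linear_combination D.a 0 * eB - D.b 0 * eA)
  have hC : D.trC ζ = (((D.coords ζ).2.2.2 * (D.θ / (2 * D.r)) : ℝ) : ℂ) := by
    rw [trC, h, ← hm, ← hn, hm0, hn0]
    push_cast
    ring
  refine ⟨-(D.coords ζ).2.2.2, ?_⟩
  obtain ⟨z1, z2, z3, z4⟩ := D.s₃_zpow_form (-(D.coords ζ).2.2.2)
  apply group_ext
  · rw [deg_mul, h, z1, add_zero]
  · rw [trA_mul, hA, z2, mul_zero, add_zero]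
  · rw [slope_mul, hB, z3, zero_mul, add_zero]
  · rw [trC_mul, hA, hC, z4, ← Complex.ofReal_mul, ← Complex.ofReal_add, ← Complex.ofReal_add]
    congr 1
    push_cast
    field_simp
    ring

/-- As `g₃ ^ r` is a commutator, every additive function on the kernel of `deg` vanishes on `g₃` and
hence is a linear combination of the translation lengths `A` and `B`. -/
lemma AdditiveOnKer.exists_eq {χ : D.group → ℝ} (hχ : D.AdditiveOnKer χ) :
    ∃ l m : ℝ, ∀ γ, D.deg γ = 0 → χ γ = l * D.trA γ + m * D.slope γ := by
  have hθ := D.θ_ne_zero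
  have hr : (D.r : ℝ) ≠ 0 := Int.cast_ne_zero.2 D.r_ne_zero
  obtain ⟨h0, a0, b0, c0⟩ := D.s_form 0
  obtain ⟨h1, a1, b1, c1⟩ := D.s_form 1
  obtain ⟨z1, z2, z3, z4⟩ := D.s₃_zpow_form D.r
  have hcomm : D.s 0 * D.s 1 = D.s₃ ^ D.r * (D.s 1 * D.s 0) := by
    apply group_ext
    · rw [deg_mul, deg_mul, deg_mul, h0, h1, z1]; ring
    · rw [trA_mul, trA_mul, trA_mul, h0, h1, z1, z2, a0, a1, zpow_zero]; ring
    · rw [slope_mul, slope_mul, slope_mul, deg_mul, h0, h1, z3, b0, b1, zpow_zero]; ring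
    · rw [trC_mul, trC_mul, trC_mul, trA_mul, h1, z3, z4, a0, a1, b0, b1, c0, c1,
        mul_div_cancel₀ _ hr, θ]
      push_cast
      ring
  have hs₃ : χ D.s₃ = 0 := by
    have := congrArg χ hcomm
    rw [hχ _ _ h0 h1, hχ _ _ z1 (by rw [deg_mul, h0, h1, add_zero]), hχ _ _ h1 h0,
      hχ.map_zpow D.s₃_form.1] at this
    exact (mul_eq_zero.1 (by linear_combination -this : (D.r : ℝ) * χ D.s₃ = 0)).resolve_left hr
  refine ⟨(D.b 1 * χ (D.s 0) - D.b 0 * χ (D.s 1)) / D.θ,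
    (D.a 0 * χ (D.s 1) - D.a 1 * χ (D.s 0)) / D.θ, fun γ hγ => ?_⟩
  obtain ⟨m, n, hA, hB⟩ : ∃ m n : ℤ, D.trA γ = m * D.a 0 + n * D.a 1 ∧
      D.slope γ = m * D.b 0 + n * D.b 1 := ⟨_, _, by rw [trA, hγ, zpow_zero, one_mul], rfl⟩
  obtain ⟨f1, f2, f3⟩ := D.s_zpow_mul_s_zpow_form m n
  have hδ : χ (D.s 0 ^ m * D.s 1 ^ n) = m * χ (D.s 0) + n * χ (D.s 1) := by
    rw [hχ _ _ (deg_zpow_eq_zero h0 m) (deg_zpow_eq_zero h1 n), hχ.map_zpow h0, hχ.map_zpow h1]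
  set δ := D.s 0 ^ m * D.s 1 ^ n
  obtain ⟨ζ, rfl⟩ : ∃ ζ, γ = ζ * δ := ⟨γ * δ⁻¹, (inv_mul_cancel_right γ δ).symm⟩
  have hζ : D.deg ζ = 0 := by rwa [deg_mul, f1, add_zero] at hγ
  have hζA : D.trA ζ = 0 := by
    have := D.additiveOnKer_trA ζ δ hζ f1
    rw [hA, f2] at this
    linarith
  have hζB : D.slope ζ = 0 := by
    have := D.additiveOnKer_slope ζ δ hζ f1
    rw [hB, f3] at this
    linarith
  obtain ⟨y, hy⟩ := exists_sq_eq_s₃_zpow hζ hζA hζB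
  have hζχ : χ ζ = 0 := by
    have := congrArg χ hy
    rw [hχ _ _ hζ hζ, hχ.map_zpow D.s₃_form.1, hs₃, mul_zero] at this
    linarith
  rw [hχ _ _ hζ f1, hζχ, hδ, hA, hB]
  field_simp
  unfold θ
  ring

/-- The functions `A` and `B` are eigenvectors, for the eigenvalues `α` and `1 / α`, of the action
of `g₀` by conjugation on additive functions. -/
lemma AdditiveOnKer.exists_eq_of_conj {χ : D.group → ℝ} (hχ : D.AdditiveOnKer χ) {ρ : ℝ}
    (h : ∀ γ, D.deg γ = 0 → χ (D.s₀ * γ * D.s₀⁻¹) = ρ * χ γ) :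
    ∃ l m : ℝ, (∀ γ, D.deg γ = 0 → χ γ = l * D.trA γ + m * D.slope γ) ∧
      l * (D.α - ρ) = 0 ∧ m * (D.α⁻¹ - ρ) = 0 := by
  obtain ⟨l, m, hlm⟩ := hχ.exists_eq
  refine ⟨l, m, hlm, eq_zero_of_forall_combination (D := D) fun γ hγ => ?_⟩
  have := h γ hγ
  rw [hlm γ hγ, hlm _ ((deg_conj _ _).trans hγ), trA_conj _ hγ, slope_conj _ hγ, D.s₀_form.1,
    zpow_one, zpow_neg_one] at this
  linear_combination this

/-- Composed with `deg`, a homomorphism gives a function that is invariant under conjugation by `g₀`,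
and `1` is not one of the eigenvalues `α` and `1 / α`. -/
lemma deg_map_eq_zero {D' : SPlusData} (f : D.group →* D'.group) {γ : D.group}
    (h : D.deg γ = 0) : D'.deg (f γ) = 0 := by
  have hχ : D.AdditiveOnKer fun γ => (D'.deg (f γ) : ℝ) := fun γ δ _ _ => by
    simp only [map_mul, deg_mul, Int.cast_add]
  obtain ⟨l, m, hlm, hl, hm⟩ := hχ.exists_eq_of_conj (ρ := 1) fun γ _ => by
    rw [map_mul, map_mul, map_inv, deg_conj, one_mul]
  have hα := D.one_lt_α
  have hα' := inv_lt_one_of_one_lt₀ hα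
  have hl0 : l = 0 := (mul_eq_zero.1 hl).resolve_right (by linarith)
  have hm0 : m = 0 := (mul_eq_zero.1 hm).resolve_right (by linarith)
  have := hlm γ h
  rw [hl0, hm0, zero_mul, zero_mul, add_zero] at this
  exact_mod_cast this

end Ker

section Iso

variable {D₁ D₂ : SPlusData}

lemma deg_map_eq (f : D₁.group →* D₂.group) (γ : D₁.group) :
    D₂.deg (f γ) = D₂.deg (f D₁.s₀) * D₁.deg γ := by
  have h : D₁.deg (D₁.s₀ ^ (-D₁.deg γ) * γ) = 0 := by
    rw [deg_mul, deg_zpow, D₁.s₀_form.1]; ring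
  have := deg_map_eq_zero f h
  rw [map_mul, map_zpow, deg_mul, deg_zpow] at this
  linear_combination this

lemma exists_deg_map_eq (φ : D₁.group ≃* D₂.group) :
    ∃ ε : ℤ, (ε = 1 ∨ ε = -1) ∧ ∀ γ, D₂.deg (φ γ) = ε * D₁.deg γ := by
  refine ⟨D₂.deg (φ D₁.s₀), ?_, fun γ => deg_map_eq φ.toMonoidHom γ⟩
  have h1 : D₁.deg (φ.symm (φ D₁.s₀)) = D₁.deg (φ.symm D₂.s₀) * D₂.deg (φ D₁.s₀) :=
    deg_map_eq φ.symm.toMonoidHom _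
  rw [φ.symm_apply_apply, D₁.s₀_form.1] at h1
  exact Int.eq_one_or_neg_one_of_mul_eq_one' h1.symm |>.elim (fun h => Or.inl h.2)
    fun h => Or.inr h.2

/-- If conjugation by `γ` multiplies `χ` by `α ^ (e deg γ)`, then an isomorphism that multiplies
degrees by `ε` pulls `χ` back to a multiple of `A` if `e ε = 1` and of `B` if `e ε = -1`. -/
lemma exists_comp_eq (φ : D₁.group ≃* D₂.group) {ε : ℤ} (hε : ∀ γ, D₂.deg (φ γ) = ε * D₁.deg γ)
    (hε0 : ε ≠ 0) {χ : D₂.group → ℝ} (hχ : D₂.AdditiveOnKer χ) {e : ℤ}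
    (hconj : ∀ g γ, D₂.deg γ = 0 → χ (g * γ * g⁻¹) = D₂.α ^ (e * D₂.deg g) * χ γ)
    (hne : ∃ γ, D₂.deg γ = 0 ∧ χ γ ≠ 0) :
    (e * ε = 1 → ∃ l : ℝ, l ≠ 0 ∧ ∀ γ, D₁.deg γ = 0 → χ (φ γ) = l * D₁.trA γ) ∧
    (e * ε = -1 → ∃ l : ℝ, l ≠ 0 ∧ ∀ γ, D₁.deg γ = 0 → χ (φ γ) = l * D₁.slope γ) := by
  have hker {γ : D₁.group} (h : D₁.deg γ = 0) : D₂.deg (φ γ) = 0 := by rw [hε, h, mul_zero]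
  have hχ' : D₁.AdditiveOnKer fun γ => χ (φ γ) := fun γ δ hγ hδ => by
    simp only [map_mul, hχ _ _ (hker hγ) (hker hδ)]
  obtain ⟨l, m, hlm, hl, hm⟩ := hχ'.exists_eq_of_conj (ρ := D₂.α ^ (e * ε)) fun γ hγ => by
    rw [map_mul, map_mul, map_inv, hconj _ _ (hker hγ), hε, D₁.s₀_form.1, mul_one]
  have hα₁ := D₁.one_lt_α
  have hα₁' := inv_lt_one_of_one_lt₀ hα₁
  have hα₂ := D₂.one_lt_α
  have hα₂' := inv_lt_one_of_one_lt₀ hα₂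
  obtain ⟨γ, hγ, hγχ⟩ := hne
  have hγ' : D₁.deg (φ.symm γ) = 0 := by
    have := hε (φ.symm γ)
    rw [φ.apply_symm_apply, hγ] at this
    exact (mul_eq_zero.1 this.symm).resolve_left hε0
  have key := hlm _ hγ'
  rw [φ.apply_symm_apply] at key
  refine ⟨fun h => ?_, fun h => ?_⟩
  · rw [h, zpow_one] at hm
    have hm0 : m = 0 := (mul_eq_zero.1 hm).resolve_right (by linarith)
    rw [hm0] at key
    refine ⟨l, ?_, fun δ hδ => by rw [hlm δ hδ, hm0, zero_mul, add_zero]⟩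
    rintro rfl
    exact hγχ (by rw [key]; ring)
  · rw [h, zpow_neg_one] at hl
    have hl0 : l = 0 := (mul_eq_zero.1 hl).resolve_right (by linarith)
    rw [hl0] at key
    refine ⟨m, ?_, fun δ hδ => by rw [hlm δ hδ, hl0, zero_mul, zero_add]⟩
    rintro rfl
    exact hγχ (by rw [key]; ring)

/-- The function `A` if `ε = 1`, and the function `B` otherwise. -/
def signedTr (D : SPlusData) (ε : ℤ) (γ : D.group) : ℝ := if ε = 1 then D.trA γ else D.slope γ

/-- The sign of `l` and the number `ε` are the invariants that distinguish the families. -/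
lemma exists_signedTr_map_eq (φ : D₁.group ≃* D₂.group) :
    ∃ ε : ℤ, ∃ l : ℝ, (ε = 1 ∨ ε = -1) ∧ l ≠ 0 ∧ (∀ γ, D₂.deg (φ γ) = ε * D₁.deg γ) ∧
      ∀ γ, D₁.deg γ = 0 → D₂.signedTr ε (φ γ) = l * D₁.trA γ := by
  obtain ⟨ε, hε, h⟩ := exists_deg_map_eq φ
  have hε0 : ε ≠ 0 := by rintro rfl; omega
  rcases hε with rfl | rfl
  · obtain ⟨l, hl, hlA⟩ := (exists_comp_eq φ h hε0 D₂.additiveOnKer_trA (e := 1)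
      (fun g γ hγ => by rw [trA_conj g hγ, one_mul]) exists_trA_ne_zero).1 (by norm_num)
    exact ⟨1, l, Or.inl rfl, hl, h, hlA⟩
  · obtain ⟨l, hl, hlA⟩ := (exists_comp_eq φ h hε0 D₂.additiveOnKer_slope (e := -1)
      (fun g γ hγ => by rw [slope_conj g hγ, neg_one_mul]) exists_slope_ne_zero).1 (by norm_num)
    exact ⟨-1, l, Or.inr rfl, hl, h, hlA⟩

end Iso

end SPlusData

/-! ### Affine maps intertwining two actions -/

/-- The automorphism `(w, z) ↦ (l w + σ, μ z + β w)` of `ℍ × ℂ`. -/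
def affineHomeo (l : {s : ℝ // 0 < s}) (σ : ℝ) (μ β : ℂ) (hμ : μ ≠ 0) : (ℍ × ℂ) ≃ₜ (ℍ × ℂ) where
  toFun x := (σ +ᵥ l • x.1, μ * x.2 + β * x.1)
  invFun x := (l⁻¹ • (-σ +ᵥ x.1), (x.2 - β * (l⁻¹ • (-σ +ᵥ x.1) : ℍ)) / μ)
  left_inv x := by
    have : l⁻¹ • (-σ +ᵥ (σ +ᵥ l • x.1)) = x.1 := by rw [neg_vadd_vadd, inv_smul_smul]
    refine Prod.ext this ?_
    simp only [this]
    field_simp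
    ring
  right_inv x := by
    have : σ +ᵥ l • l⁻¹ • (-σ +ᵥ x.1) = x.1 := by rw [smul_inv_smul, vadd_neg_vadd]
    refine Prod.ext this ?_
    simp only
    field_simp
    ring
  continuous_toFun := by
    have h1 := (UpperHalfPlane.isometry_pos_mul l).continuous
    have h2 := (UpperHalfPlane.isometry_real_vadd σ).continuous
    have h3 := UpperHalfPlane.continuous_coe
    fun_prop
  continuous_invFun := by
    have h1 := (UpperHalfPlane.isometry_pos_mul l⁻¹).continuous
    have h2 := (UpperHalfPlane.isometry_real_vadd (-σ)).continuous
    have h3 := UpperHalfPlane.continuous_coe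
    fun_prop (disch := assumption)

lemma affineHomeo_coe_fst (l : {s : ℝ // 0 < s}) (σ : ℝ) (μ β : ℂ) (hμ : μ ≠ 0) (x : ℍ × ℂ) :
    ((affineHomeo l σ μ β hμ x).1 : ℂ) = (l : ℝ) * x.1 + σ := by
  change (((σ +ᵥ l • x.1 : ℍ)) : ℂ) = _
  rw [UpperHalfPlane.coe_vadd, UpperHalfPlane.coe_pos_real_smul, Complex.real_smul, add_comm]

lemma affineHomeo_snd (l : {s : ℝ // 0 < s}) (σ : ℝ) (μ β : ℂ) (hμ : μ ≠ 0) (x : ℍ × ℂ) :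
    (affineHomeo l σ μ β hμ x).2 = μ * x.2 + β * x.1 := rfl

/-- The translation of the second coordinate of `ℍ × ℂ` by `v`. -/
def shiftSnd (v : ℂ) (x : ℍ × ℂ) : ℍ × ℂ := (x.1, x.2 + v)

@[simp] lemma shiftSnd_fst (v : ℂ) (x : ℍ × ℂ) : (shiftSnd v x).1 = x.1 := rfl

@[simp] lemma shiftSnd_snd (v : ℂ) (x : ℍ × ℂ) : (shiftSnd v x).2 = x.2 + v := rfl

lemma shiftSnd_shiftSnd (u v : ℂ) (x : ℍ × ℂ) :
    shiftSnd u (shiftSnd v x) = shiftSnd (u + v) x :=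
  Prod.ext rfl (by simp; ring)

lemma shiftSnd_zero (x : ℍ × ℂ) : shiftSnd 0 x = x := Prod.ext rfl (add_zero _)

namespace SPlusData

variable {D D₁ D₂ : SPlusData}

lemma smul_shiftSnd (γ : D.group) (v : ℂ) (x : ℍ × ℂ) :
    γ • shiftSnd v x = shiftSnd v (γ • x) := by
  refine Prod.ext (UpperHalfPlane.ext ?_) ?_
  · rw [shiftSnd_fst, coe_smul_fst, coe_smul_fst, shiftSnd_fst]
  · rw [shiftSnd_snd, smul_snd, smul_snd, shiftSnd_fst, shiftSnd_snd]
    ring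

lemma re_trC_mul (γ δ : D.group) :
    (D.trC (γ * δ)).re = (D.trC δ).re + D.slope γ * D.trA δ + (D.trC γ).re := by
  rw [trC_mul, ← Complex.ofReal_mul, Complex.add_re, Complex.add_re, Complex.ofReal_re]

lemma trC_eq_ofReal {γ : D.group} (h : D.deg γ = 0) : D.trC γ = ((D.trC γ).re : ℝ) :=
  Complex.ext (by simp) (by simp [D.trC_im_of_deg_eq_zero h])

/-- An isomorphism that respects degrees and multiplies `A` by a positive number is induced by an
affine automorphism of `ℍ × ℂ`, up to a change of the parameter `t`. -/
theorem exists_intertwining (φ : D₁.group ≃* D₂.group) (hdeg : ∀ γ, D₂.deg (φ γ) = D₁.deg γ)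
    (l : {s : ℝ // 0 < s}) (hA : ∀ γ, D₁.deg γ = 0 → D₂.trA (φ γ) = l * D₁.trA γ) :
    ∃ (σ : ℝ) (μ β : ℂ) (hμ : μ ≠ 0) (t : ℂ), ∀ γ x,
      φ γ • affineHomeo l σ μ β hμ x
        = shiftSnd (D₁.deg γ * t) (affineHomeo l σ μ β hμ (γ • x)) := by
  have hl : (l : ℝ) ≠ 0 := l.2.ne'
  have hker {γ : D₁.group} (h : D₁.deg γ = 0) : D₂.deg (φ γ) = 0 := by rw [hdeg, h]
  obtain ⟨ν, hν, hB⟩ := (exists_comp_eq φ (ε := 1) (fun γ => by rw [hdeg, one_mul]) one_ne_zero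
    D₂.additiveOnKer_slope (e := -1) (fun g γ hγ => by rw [slope_conj g hγ, neg_one_mul])
    exists_slope_ne_zero).2 (by norm_num)
  have hα : D₂.α = D₁.α := by
    obtain ⟨γ, hγ, hγA⟩ := exists_trA_ne_zero (D := D₁)
    have h1 := hA _ ((deg_conj D₁.s₀ γ).trans hγ)
    rw [map_mul, map_mul, map_inv, trA_conj _ (hker hγ), trA_conj _ hγ, hdeg, D₁.s₀_form.1, zpow_one,
      zpow_one, hA γ hγ] at h1
    exact mul_right_cancel₀ (mul_ne_zero hl hγA) (by linear_combination h1)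
  -- the terms `slope * trA` in the composition law of `C` cancel, as `φ` multiplies them by `l * ν`
  have hχ : D₁.AdditiveOnKer fun γ => (D₂.trC (φ γ)).re - l * ν * (D₁.trC γ).re :=
    fun γ δ hγ hδ => by
      simp only [map_mul, re_trC_mul, hA δ hδ, hB γ hγ]
      ring
  obtain ⟨p, q, hpq⟩ := hχ.exists_eq
  -- conjugation by the automorphism changes `C` by `β A - σ ν B` on the kernel of `deg`
  obtain ⟨σ, hq⟩ : ∃ σ, q = -(ν * σ) := ⟨-(q / ν), by field_simp⟩
  obtain ⟨-, hA₀, hB₀, hC₀⟩ := D₁.s₀_form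
  -- compare the conjugates by `g₀` of elements of the kernel of `deg` under both actions
  obtain ⟨h1, h2⟩ := eq_zero_of_forall_combination (D := D₁)
    (l := p * (D₁.α - 1) - l * D₂.slope (φ D₁.s₀))
    (m := q * (D₁.α⁻¹ - 1) + ν * D₁.α⁻¹ * D₂.trA (φ D₁.s₀)) fun γ hγ => by
      have hγ' := (deg_conj D₁.s₀ γ).trans hγ
      have e := inv_mul_cancel_right (D₁.s₀ * γ) D₁.s₀
      have e1 := congrArg (fun δ => (D₁.trC δ).re) e
      have e2 := congrArg (fun δ => (D₂.trC (φ δ)).re) e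
      have e3 := hpq _ hγ
      have e4 := hpq _ hγ'
      rw [re_trC_mul (D₁.s₀ * γ * D₁.s₀⁻¹), re_trC_mul D₁.s₀ γ, hA₀, hB₀] at e1
      rw [map_mul φ (D₁.s₀ * γ * D₁.s₀⁻¹), map_mul φ D₁.s₀ γ, re_trC_mul, re_trC_mul,
        hB _ hγ', hA _ hγ, slope_conj _ hγ, D₁.s₀_form.1, zpow_neg_one] at e2
      rw [trA_conj _ hγ, slope_conj _ hγ, D₁.s₀_form.1, zpow_neg_one, zpow_one] at e4
      linear_combination e3 - e4 + e2 - l * ν * e1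
  have hμ : ((l * ν : ℝ) : ℂ) ≠ 0 := Complex.ofReal_ne_zero.2 (mul_ne_zero hl hν)
  have hα0 := D₁.α_pos.ne'
  have hA₂ : D₂.trA (φ D₁.s₀) = σ * (1 - D₁.α) := by
    rw [hq] at h2
    have : ν * D₁.α⁻¹ ≠ 0 := mul_ne_zero hν (inv_ne_zero hα0)
    refine mul_left_cancel₀ this ?_
    linear_combination h2 + ν * σ * mul_inv_cancel₀ hα0
  have hB₂ : (l : ℝ) * D₂.slope (φ D₁.s₀) = p * (D₁.α - 1) := by linarith
  refine ⟨σ, ((l * ν : ℝ) : ℂ), (p : ℂ), hμ,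
    D₂.slope (φ D₁.s₀) * σ + D₂.trC (φ D₁.s₀) - (l * ν : ℝ) * D₁.t, ?_⟩
  set T := affineHomeo l σ ((l * ν : ℝ) : ℂ) (p : ℂ) hμ with hT
  set t := D₂.slope (φ D₁.s₀) * σ + D₂.trC (φ D₁.s₀) - (l * ν : ℝ) * D₁.t with ht
  -- `S` is the whole group, as it contains `g₀` and the kernel of `deg`
  let S : Subgroup D₁.group :=
    { carrier := {γ | ∀ x, φ γ • T x = shiftSnd (D₁.deg γ * t) (T (γ • x))}
      mul_mem' := fun {γ δ} hγ hδ x => by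
        rw [map_mul, mul_smul, hδ, smul_shiftSnd, hγ, shiftSnd_shiftSnd, mul_smul, deg_mul]
        congr 1
        push_cast
        ring
      one_mem' := fun x => by
        rw [map_one, one_smul, one_smul, deg_one, Int.cast_zero, zero_mul, shiftSnd_zero]
      inv_mem' := fun {γ} hγ x => by
        rw [map_inv, inv_smul_eq_iff, smul_shiftSnd, hγ, shiftSnd_shiftSnd, smul_inv_smul, deg_inv,
          Int.cast_neg, neg_mul, neg_add_cancel, shiftSnd_zero] }
  have hS₀ : D₁.s₀ ∈ S := fun x => by
    have hA₂' := congrArg Complex.ofReal hA₂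
    have hB₂' := congrArg Complex.ofReal hB₂
    push_cast at hA₂' hB₂'
    refine Prod.ext (UpperHalfPlane.ext ?_) ?_
    · rw [coe_smul_fst, shiftSnd_fst, hT, affineHomeo_coe_fst, affineHomeo_coe_fst, coe_smul_fst,
        hdeg, D₁.s₀_form.1, zpow_one, zpow_one, hA₀, hA₂, hα]
      push_cast
      ring
    · rw [smul_snd, shiftSnd_snd, hT, affineHomeo_snd, affineHomeo_snd, affineHomeo_coe_fst,
        coe_smul_fst, smul_snd, D₁.s₀_form.1, zpow_one, hA₀, hB₀, hC₀, ht]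
      push_cast
      linear_combination x.1 * hB₂'
  have hSker (γ : D₁.group) (hγ : D₁.deg γ = 0) : γ ∈ S := fun x => by
    refine Prod.ext (UpperHalfPlane.ext ?_) ?_
    · rw [coe_smul_fst, shiftSnd_fst, hT, affineHomeo_coe_fst, affineHomeo_coe_fst, coe_smul_fst,
        hdeg, hγ, zpow_zero, zpow_zero, hA γ hγ]
      push_cast
      ring
    · have e := congrArg Complex.ofReal (hpq γ hγ)
      rw [hq] at e
      rw [smul_snd, shiftSnd_snd, hT, affineHomeo_snd, affineHomeo_snd, affineHomeo_coe_fst,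
        coe_smul_fst, smul_snd, hγ, zpow_zero, hB γ hγ, trC_eq_ofReal hγ,
        trC_eq_ofReal (hker hγ)]
      push_cast at e ⊢
      linear_combination e
  intro γ
  have h : D₁.deg (D₁.s₀ ^ (-D₁.deg γ) * γ) = 0 := by
    rw [deg_mul, deg_zpow, D₁.s₀_form.1]; ring
  have : γ = D₁.s₀ ^ D₁.deg γ * (D₁.s₀ ^ (-D₁.deg γ) * γ) := by
    rw [← mul_assoc, ← zpow_add, add_neg_cancel, zpow_zero, one_mul]
  rw [this]
  exact S.mul_mem (S.zpow_mem hS₀ _) (hSker _ h)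

end SPlusData

/-! ### The family obtained by varying the parameter `t` -/

/-- The inclusion of `(ℍ × ℂ) × ℂ` into `(ℂ × ℂ) × ℂ`. -/
def coeProd (u : (ℍ × ℂ) × ℂ) : (ℂ × ℂ) × ℂ := (((u.1.1 : ℂ), u.1.2), u.2)

lemma isOpenEmbedding_coeProd : Topology.IsOpenEmbedding coeProd :=
  (UpperHalfPlane.isOpenEmbedding_coe.prodMap .id).prodMap .id

/-- The inclusion of `(ℍ × ℂ) × ℂ` into `(ℂ × ℂ) × ℂ`, as a chart. -/
def coeProdChart : OpenPartialHomeomorph ((ℍ × ℂ) × ℂ) ((ℂ × ℂ) × ℂ) :=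
  isOpenEmbedding_coeProd.toOpenPartialHomeomorph coeProd

lemma coeProd_coeProdChart_symm {w : (ℂ × ℂ) × ℂ} (hw : w ∈ coeProdChart.target) :
    coeProd (coeProdChart.symm w) = w :=
  coeProdChart.right_inv hw

/-- The automorphism `((w, z), s) ↦ ((l w + σ, μ z + β w), s + v)` of `(ℂ × ℂ) × ℂ`. -/
def affineHomeoProd (l σ μ β v : ℂ) (hl : l ≠ 0) (hμ : μ ≠ 0) :
    ((ℂ × ℂ) × ℂ) ≃ₜ ((ℂ × ℂ) × ℂ) where
  toFun x := ((l * x.1.1 + σ, μ * x.1.2 + β * x.1.1), x.2 + v)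
  invFun x := (((x.1.1 - σ) / l, (x.1.2 - β * ((x.1.1 - σ) / l)) / μ), x.2 - v)
  left_inv x := by
    refine Prod.ext (Prod.ext ?_ ?_) ?_ <;> simp [hl, hμ]
  right_inv x := by
    refine Prod.ext (Prod.ext ?_ ?_) ?_ <;> simp [mul_div_cancel₀, hl, hμ]
  continuous_toFun := by fun_prop
  continuous_invFun := by fun_prop (disch := assumption)

lemma contDiff_affineHomeoProd (l σ μ β v : ℂ) (hl : l ≠ 0) (hμ : μ ≠ 0) :
    ContDiff ℂ ω (affineHomeoProd l σ μ β v hl hμ) := by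
  change ContDiff ℂ ω fun x : (ℂ × ℂ) × ℂ => ((l * x.1.1 + σ, μ * x.1.2 + β * x.1.1), x.2 + v)
  fun_prop

lemma contDiff_affineHomeoProd_symm (l σ μ β v : ℂ) (hl : l ≠ 0) (hμ : μ ≠ 0) :
    ContDiff ℂ ω (affineHomeoProd l σ μ β v hl hμ).symm := by
  change ContDiff ℂ ω fun x : (ℂ × ℂ) × ℂ =>
    (((x.1.1 - σ) / l, (x.1.2 - β * ((x.1.1 - σ) / l)) / μ), x.2 - v)
  fun_prop

namespace SPlusData

variable (D : SPlusData)

/-- The total space of the family of the surfaces obtained from `D` by adding `s ∈ ℂ` to the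
parameter `t`. As a topological space it is a product: the complex structure is the one for which
`SPlusData.famProj` is locally biholomorphic. -/
def Family : Type := D.Surface × ℂ

instance : TopologicalSpace D.Family := inferInstanceAs (TopologicalSpace (D.Surface × ℂ))

instance : T2Space D.Family := inferInstanceAs (T2Space (D.Surface × ℂ))

instance : SecondCountableTopology D.Family :=
  inferInstanceAs (SecondCountableTopology (D.Surface × ℂ))

instance : ConnectedSpace D.Family := inferInstanceAs (ConnectedSpace (D.Surface × ℂ))

/-- The projection of the family to its base `ℂ`. -/
def famBase (x : D.Family) : ℂ := x.2

/-- The number `log (im w) / log α`, to which `γ` adds `deg γ`. -/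
def height (x : ℍ × ℂ) : ℝ := Real.log x.1.im / Real.log D.α

lemma height_smul (γ : D.group) (x : ℍ × ℂ) : D.height (γ • x) = D.deg γ + D.height x := by
  rw [height, height, im_smul_fst, Real.log_mul (D.zpow_α_pos _).ne' x.1.im_ne_zero, Real.log_zpow,
    add_div, mul_div_cancel_right₀ _ (Real.log_pos D.one_lt_α).ne']

lemma height_shiftSnd (v : ℂ) (x : ℍ × ℂ) : D.height (shiftSnd v x) = D.height x := rfl

lemma continuous_height : Continuous D.height :=
  (UpperHalfPlane.continuous_im.comp continuous_fst).log (fun x => x.1.im_ne_zero)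
    |>.div_const _

/-- The homeomorphism of `(ℍ × ℂ) × ℂ` that makes the action of `G⁺` on the second copy of `ℂ`
trivial. -/
def untwist : ((ℍ × ℂ) × ℂ) ≃ₜ ((ℍ × ℂ) × ℂ) where
  toFun u := (shiftSnd (-(D.height u.1 * u.2)) u.1, u.2)
  invFun u := (shiftSnd (D.height u.1 * u.2) u.1, u.2)
  left_inv u := by
    simp only [height_shiftSnd, shiftSnd_shiftSnd, add_neg_cancel, shiftSnd_zero]
  right_inv u := by
    simp only [height_shiftSnd, shiftSnd_shiftSnd, neg_add_cancel, shiftSnd_zero]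
  continuous_toFun := by
    have := D.continuous_height
    unfold shiftSnd
    fun_prop
  continuous_invFun := by
    have := D.continuous_height
    unfold shiftSnd
    fun_prop

/-- The action of `G⁺` on `(ℍ × ℂ) × ℂ` whose restriction to `(ℍ × ℂ) × {s}` is the action
for the parameter `t + s`. -/
def famAct (γ : D.group) (u : (ℍ × ℂ) × ℂ) : (ℍ × ℂ) × ℂ :=
  (shiftSnd (D.deg γ * u.2) (γ • u.1), u.2)

lemma continuous_famAct (γ : D.group) : Continuous (D.famAct γ) := by
  have : Continuous fun x : ℍ × ℂ => γ • x := continuous_const_smul γ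
  unfold famAct shiftSnd
  fun_prop

/-- The quotient map from `(ℍ × ℂ) × ℂ` to the total space of the family. -/
def famProj (u : (ℍ × ℂ) × ℂ) : D.Family := (D.proj (D.untwist u).1, u.2)

lemma isLocalHomeomorph_famProj : IsLocalHomeomorph D.famProj :=
  have h : IsLocalHomeomorph (Prod.map D.proj (id : ℂ → ℂ)) := fun x => by
    obtain ⟨e, he, hD⟩ := D.isLocalHomeomorph_proj x.1
    exact ⟨e.prod (OpenPartialHomeomorph.refl ℂ), ⟨he, Set.mem_univ _⟩, by rw [hD]; rfl⟩
  h.comp D.untwist.isLocalHomeomorph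

lemma surjective_famProj : Function.Surjective D.famProj := by
  rintro ⟨x, s⟩
  obtain ⟨y, rfl⟩ := D.surjective_proj x
  refine ⟨D.untwist.symm (y, s), Prod.ext ?_ rfl⟩
  simp only [famProj, Homeomorph.apply_symm_apply]

variable {D}

/-- The fibres of `famProj` are the orbits of the twisted action, because `γ` adds `deg γ` to the
height. -/
lemma famProj_eq_iff {u v : (ℍ × ℂ) × ℂ} :
    D.famProj u = D.famProj v ↔ ∃ γ : D.group, v = D.famAct γ u := by
  constructor
  · intro h
    have h2 : u.2 = v.2 := congrArg D.famBase h
    have h1 : D.proj (shiftSnd (-(D.height u.1 * u.2)) u.1)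
      = D.proj (shiftSnd (-(D.height v.1 * v.2)) v.1) :=
      congrArg (fun x : D.Family => x.1) h
    obtain ⟨γ, hγ⟩ := D.proj_eq_iff.1 h1.symm
    have hγ' : γ • shiftSnd (-(D.height u.1 * u.2)) u.1
      = shiftSnd (-(D.height v.1 * v.2)) v.1 := hγ
    have hh := congrArg D.height hγ'
    rw [height_smul, height_shiftSnd, height_shiftSnd] at hh
    refine ⟨γ, Prod.ext ?_ h2.symm⟩
    have e := congrArg (shiftSnd (D.height v.1 * v.2)) hγ'
    rw [smul_shiftSnd, shiftSnd_shiftSnd, shiftSnd_shiftSnd, add_neg_cancel, shiftSnd_zero] at e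
    rw [← e, famAct]
    simp only
    congr 1
    rw [← h2, ← hh]
    push_cast
    ring
  · rintro ⟨γ, rfl⟩
    refine Prod.ext ?_ rfl
    change D.proj (shiftSnd (-(D.height u.1 * u.2)) u.1)
      = D.proj (shiftSnd (-(D.height (shiftSnd (D.deg γ * u.2) (γ • u.1)) * u.2))
          (shiftSnd (D.deg γ * u.2) (γ • u.1)))
    rw [height_shiftSnd, height_smul, shiftSnd_shiftSnd, ← smul_shiftSnd, ← D.proj_smul γ]
    congr 3
    push_cast
    ring

variable (D)

/-- The automorphism of `(ℂ × ℂ) × ℂ` by which `γ` acts on `(ℍ × ℂ) × ℂ`. -/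
def famActExt (γ : D.group) (x : (ℂ × ℂ) × ℂ) : (ℂ × ℂ) × ℂ :=
  ((((D.α ^ D.deg γ : ℝ) : ℂ) * x.1.1 + D.trA γ,
    x.1.2 + D.slope γ * x.1.1 + D.trC γ + D.deg γ * x.2), x.2)

lemma contDiff_famActExt (γ : D.group) : ContDiff ℂ ω (D.famActExt γ) := by
  unfold famActExt
  fun_prop

lemma famActExt_coeProd (γ : D.group) (u : (ℍ × ℂ) × ℂ) :
    D.famActExt γ (coeProd u) = coeProd (D.famAct γ u) := by
  simp only [famActExt, coeProd, famAct, shiftSnd_fst, shiftSnd_snd, coe_smul_fst, smul_snd]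

/-- The chart of the total space given by the local inverse of `famProj` at `p`, followed by an
automorphism `h` of `(ℂ × ℂ) × ℂ`. -/
def famChart (p : (ℍ × ℂ) × ℂ) (h : ((ℂ × ℂ) × ℂ) ≃ₜ ((ℂ × ℂ) × ℂ)) :
    OpenPartialHomeomorph D.Family ((ℂ × ℂ) × ℂ) :=
  ((D.isLocalHomeomorph_famProj.localInverseAt p).trans coeProdChart).trans
    h.toOpenPartialHomeomorph

lemma famChart_apply (p : (ℍ × ℂ) × ℂ) (h : ((ℂ × ℂ) × ℂ) ≃ₜ ((ℂ × ℂ) × ℂ)) (x : D.Family) :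
    D.famChart p h x = h (coeProd (D.isLocalHomeomorph_famProj.localInverseAt p x)) := rfl

lemma famChart_source (p : (ℍ × ℂ) × ℂ) (h : ((ℂ × ℂ) × ℂ) ≃ₜ ((ℂ × ℂ) × ℂ)) :
    (D.famChart p h).source = (D.isLocalHomeomorph_famProj.localInverseAt p).source := by
  simp [famChart, coeProdChart]

lemma famChart_symm_apply (p : (ℍ × ℂ) × ℂ) (h : ((ℂ × ℂ) × ℂ) ≃ₜ ((ℂ × ℂ) × ℂ))
    (w : (ℂ × ℂ) × ℂ) :
    (D.famChart p h).symm w = D.famProj (coeProdChart.symm (h.symm w)) :=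
  congrFun (D.isLocalHomeomorph_famProj.localInverseAt_symm p) _

lemma mem_famChart_target {p : (ℍ × ℂ) × ℂ} {h : ((ℂ × ℂ) × ℂ) ≃ₜ ((ℂ × ℂ) × ℂ)}
    {w : (ℂ × ℂ) × ℂ} (hw : w ∈ (D.famChart p h).target) : h.symm w ∈ coeProdChart.target := by
  simp only [famChart, mfld_simps] at hw
  exact hw.1

lemma mem_famChart_source (p : (ℍ × ℂ) × ℂ) (h : ((ℂ × ℂ) × ℂ) ≃ₜ ((ℂ × ℂ) × ℂ)) :
    D.famProj p ∈ (D.famChart p h).source := by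
  rw [famChart_source]
  exact D.isLocalHomeomorph_famProj.apply_self_mem_localInverseAt_source

/-- The charts of the total space are the local inverses of `famProj`, followed by arbitrary
holomorphic automorphisms of `(ℂ × ℂ) × ℂ`. -/
instance : ChartedSpace ((ℂ × ℂ) × ℂ) D.Family where
  atlas := {e | ∃ p, ∃ h : ((ℂ × ℂ) × ℂ) ≃ₜ ((ℂ × ℂ) × ℂ),
    ContDiff ℂ ω h ∧ ContDiff ℂ ω h.symm ∧ e = D.famChart p h}
  chartAt x := D.famChart (D.surjective_famProj x).choose (Homeomorph.refl _)
  mem_chart_source x := by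
    have := D.mem_famChart_source (D.surjective_famProj x).choose (Homeomorph.refl _)
    rwa [(D.surjective_famProj x).choose_spec] at this
  chart_mem_atlas x := ⟨_, Homeomorph.refl _, contDiff_id, contDiff_id, rfl⟩

lemma famChart_mem_atlas (p : (ℍ × ℂ) × ℂ) {h : ((ℂ × ℂ) × ℂ) ≃ₜ ((ℂ × ℂ) × ℂ)}
    (h1 : ContDiff ℂ ω h) (h2 : ContDiff ℂ ω h.symm) :
    D.famChart p h ∈ atlas ((ℂ × ℂ) × ℂ) D.Family :=
  ⟨p, h, h1, h2, rfl⟩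

/-- The transition functions are locally given by the action of an element of `G⁺`. -/
instance : IsManifold 𝓘(ℂ, (ℂ × ℂ) × ℂ) ω D.Family := by
  refine isManifold_of_contDiffOn _ _ _ ?_
  rintro _ _ ⟨p, h, -, h2, rfl⟩ ⟨p', h', h1', -, rfl⟩ w hw
  have hP := D.isLocalHomeomorph_famProj
  set L := hP.localInverseAt p'
  have hw' : w ∈ ((D.famChart p h).symm.trans (D.famChart p' h')).source := hw.1
  rw [OpenPartialHomeomorph.trans_source, OpenPartialHomeomorph.symm_source] at hw'
  have hwt := D.mem_famChart_target hw'.1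
  have hws : D.famProj (coeProdChart.symm (h.symm w)) ∈ L.source := by
    have := hw'.2
    rwa [Set.mem_preimage, famChart_symm_apply, famChart_source] at this
  obtain ⟨γ, hγ⟩ := famProj_eq_iff.1 (hP.apply_localInverseAt_of_mem hws).symm
  have hF : ContDiff ℂ ω (h' ∘ D.famActExt γ ∘ h.symm) :=
    h1'.comp ((D.contDiff_famActExt γ).comp h2)
  refine hF.contDiffAt.contDiffWithinAt.congr_of_eventuallyEq_of_mem ?_ hw
  refine Filter.Eventually.filter_mono nhdsWithin_le_nhds ?_
  have c1 : ContinuousAt (fun w => coeProdChart.symm (h.symm w)) w :=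
    (coeProdChart.continuousAt_symm hwt).comp h.symm.continuous.continuousAt
  have e1 : ∀ᶠ w' in 𝓝 w, h.symm w' ∈ coeProdChart.target :=
    h.symm.continuous.continuousAt.eventually (coeProdChart.open_target.mem_nhds hwt)
  have e2 : ∀ᶠ w' in 𝓝 w, D.famProj (coeProdChart.symm (h.symm w')) ∈ L.source :=
    (hP.continuous.continuousAt.comp c1).eventually (L.open_source.mem_nhds hws)
  have e3 : ∀ᶠ w' in 𝓝 w, D.famAct γ (coeProdChart.symm (h.symm w')) ∈ L.target := by
    refine ((D.continuous_famAct γ).continuousAt.comp c1).eventually (L.open_target.mem_nhds ?_)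
    change D.famAct γ (coeProdChart.symm (h.symm w)) ∈ L.target
    rw [← hγ]
    exact L.map_source hws
  filter_upwards [e1, e2, e3] with w' h1 h2 h3
  have key : L (D.famProj (coeProdChart.symm (h.symm w')))
      = D.famAct γ (coeProdChart.symm (h.symm w')) := by
    refine hP.injOn_localInverseAt_target (L.map_source h2) h3 ?_
    rw [hP.apply_localInverseAt_of_mem h2]
    exact famProj_eq_iff.2 ⟨γ, rfl⟩
  change D.famChart p' h' ((D.famChart p h).symm w') = h' (D.famActExt γ (h.symm w'))
  rw [famChart_symm_apply, famChart_apply, key, ← famActExt_coeProd, coeProd_coeProdChart_symm h1]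

lemma isComplexManifold_family : IsComplexManifold 𝓘(ℂ, (ℂ × ℂ) × ℂ) D.Family where
  finiteDimensional := inferInstance
  boundaryless := inferInstance
  t2Space := inferInstance
  secondCountableTopology := inferInstance
  isManifold := inferInstance

lemma isProperMap_famBase : IsProperMap D.famBase :=
  isProperMap_snd_of_compactSpace (X := D.Surface) (Y := ℂ)

/-- In the charts given by local inverses of `famProj`, the projection is the last coordinate. -/
lemma isSubmersion_famBase :
    Manifold.IsSubmersion 𝓘(ℂ, (ℂ × ℂ) × ℂ) 𝓘(ℂ, ℂ) ω D.famBase := by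
  refine Manifold.IsSubmersionOfComplement.isSubmersion (F := ℂ × ℂ) fun x => ?_
  obtain ⟨p, rfl⟩ := D.surjective_famProj x
  refine Manifold.IsSubmersionAtOfComplement.mk_of_continuousAt
    D.isProperMap_famBase.continuous.continuousAt (ContinuousLinearEquiv.prodComm ℂ (ℂ × ℂ) ℂ)
    (D.famChart p (Homeomorph.refl _)) (OpenPartialHomeomorph.refl ℂ)
    (D.mem_famChart_source p _) (Set.mem_univ _)
    (IsManifold.subset_maximalAtlas (D.famChart_mem_atlas p contDiff_id contDiff_id))
    (IsManifold.subset_maximalAtlas (by simp)) ?_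
  intro w hw
  have hw' : w ∈ (D.famChart p (Homeomorph.refl _)).target := by simpa using hw
  have e := congrArg Prod.snd (coeProd_coeProdChart_symm (D.mem_famChart_target hw'))
  change D.famBase ((D.famChart p (Homeomorph.refl _)).symm w) = w.2
  rw [famChart_symm_apply]
  exact e

variable {D}

/-- An affine automorphism of `ℍ × ℂ` that intertwines the actions for `D'` and for `D`, with the
parameter `t` of `D` replaced by `t + v`, exhibits the surface of `D'` as the fibre over `v`. -/
theorem fibreBiholomorphic_of_affineHomeo {D' : SPlusData} (l : {s : ℝ // 0 < s}) (σ : ℝ)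
    (μ β : ℂ) (hμ : μ ≠ 0) (v : ℂ)
    (h : ∀ x y, D'.proj x = D'.proj y ↔
      D.famProj (affineHomeo l σ μ β hμ x, v) = D.famProj (affineHomeo l σ μ β hμ y, v)) :
    FibreBiholomorphic model 𝓘(ℂ, (ℂ × ℂ) × ℂ) D.famBase v D'.Surface := by
  set T := affineHomeo l σ μ β hμ
  let f : D'.Surface → D.Family := Quotient.lift (fun x => D.famProj (T x, v))
    fun x y hxy => (h x y).1 (Quotient.sound hxy)
  have hf (x : ℍ × ℂ) : f (D'.proj x) = D.famProj (T x, v) := rfl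
  have hP := D.isLocalHomeomorph_famProj
  have hcont : Continuous f :=
    (hP.continuous.comp (T.continuous.prodMk continuous_const)).quotient_lift _
  have hinj : Function.Injective f := by
    intro x y hxy
    obtain ⟨x, rfl⟩ := D'.surjective_proj x
    obtain ⟨y, rfl⟩ := D'.surjective_proj y
    exact (h x y).2 hxy
  refine ⟨f, ⟨?_, (hcont.isClosedEmbedding hinj).isEmbedding⟩, ?_⟩
  · refine Manifold.IsImmersionOfComplement.isImmersion (F := ℂ) fun x => ?_
    set hp := D'.isLocalHomeomorph_proj
    set u := D'.surjective_proj.hasRightInverse.choose x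
    have hu : D'.proj u = x := D'.surjective_proj.hasRightInverse.choose_spec x
    set Lu := hp.localInverseAt u with hLu
    set φ := chartAt (ModelProd ℂ ℂ) u
    set L := hP.localInverseAt (T u, v)
    have hl : ((l : ℝ) : ℂ) ≠ 0 := Complex.ofReal_ne_zero.2 l.2.ne'
    set A := affineHomeoProd (l : ℝ) σ μ β v hl hμ
    have hA (y : ℍ × ℂ) : A (((y.1 : ℂ), y.2), 0) = coeProd (T y, v) := by
      refine Prod.ext (Prod.ext ?_ rfl) (zero_add v)
      exact (affineHomeo_coe_fst l σ μ β hμ y).symm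
    -- the part of the chart of `D'` that `T` maps into the domain of injectivity of `famProj`
    set O : Set D'.Surface := Lu.source ∩ Lu ⁻¹' ((fun y => (T y, v)) ⁻¹' L.target)
    have hO : IsOpen O := Lu.isOpen_inter_preimage
      (L.open_target.preimage (T.continuous.prodMk continuous_const))
    have hxO : x ∈ O := by
      rw [← hu]
      refine ⟨hp.apply_self_mem_localInverseAt_source, ?_⟩
      rw [Set.mem_preimage, hLu, hp.localInverseAt_apply_self]
      exact hP.self_mem_localInverseAt_target
    refine Manifold.IsImmersionAtOfComplement.mk_of_continuousAt hcont.continuousAt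
      (ContinuousLinearEquiv.refl ℂ ((ℂ × ℂ) × ℂ))
      ((chartAt (ModelProd ℂ ℂ) x).restr O) (D.famChart (T u, v) A.symm) ?_ ?_ ?_
      (IsManifold.subset_maximalAtlas (D.famChart_mem_atlas _
        (contDiff_affineHomeoProd_symm _ _ _ _ _ hl hμ)
        (contDiff_affineHomeoProd _ _ _ _ _ hl hμ))) ?_
    · rw [OpenPartialHomeomorph.restr_source, hO.interior_eq]
      exact ⟨mem_chart_source _ x, hxO⟩
    · rw [← hu, hf]
      exact D.mem_famChart_source _ _
    · exact restr_mem_maximalAtlas _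
        (IsManifold.subset_maximalAtlas (chart_mem_atlas _ x)) hO
    · intro w hw
      have hw' : w ∈ ((Lu.trans φ).restr O).target := by
        rw [OpenPartialHomeomorph.extend_target] at hw
        exact hw.1
      have hws := ((Lu.trans φ).restr O).map_target hw'
      rw [OpenPartialHomeomorph.restr_source, hO.interior_eq] at hws
      have hwφ : w ∈ φ.target := by
        simp only [mfld_simps] at hw'
        exact hw'.1.1
      set y := φ.symm w
      have hyw : ((y.1 : ℂ), y.2) = w := φ.right_inv hwφ
      have hsymm : ((Lu.trans φ).restr O).symm w = D'.proj y :=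
        congrFun (hp.localInverseAt_symm u) _
      have hyL : Lu (D'.proj y) = y := by
        rw [← congrFun (hp.localInverseAt_symm u) y]
        refine Lu.right_inv ?_
        simp only [mfld_simps] at hw'
        exact hw'.1.2
      rw [hsymm] at hws
      have hyO : (T y, v) ∈ L.target := by
        have := hws.2.2
        rwa [Set.mem_preimage, hyL] at this
      change D.famChart (T u, v) A.symm (f (((Lu.trans φ).restr O).symm w)) = (w, 0)
      rw [hsymm, hf, famChart_apply, Homeomorph.symm_apply_eq, ← hyw, hA]
      congr 1
      rw [← congrFun (hP.localInverseAt_symm (T u, v))]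
      exact L.right_inv hyO
  · ext x
    constructor
    · rintro ⟨y, rfl⟩
      obtain ⟨y, rfl⟩ := D'.surjective_proj y
      rfl
    · rintro rfl
      obtain ⟨⟨y, s⟩, rfl⟩ := D.surjective_famProj x
      refine ⟨D'.proj (T.symm y), ?_⟩
      rw [hf, T.apply_symm_apply]
      rfl

end SPlusData

/-! ### Homotopy equivalent surfaces -/

namespace SPlusData

variable {D D₁ D₂ : SPlusData}

/-- The group `G⁺` is the fundamental group of the surface, hence a homotopy invariant. -/
lemma nonempty_mulEquiv_of_homotopyEquiv (e : ContinuousMap.HomotopyEquiv D₁.Surface D₂.Surface) :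
    Nonempty (D₁.group ≃* D₂.group) := by
  let x : ℍ × ℂ := (UpperHalfPlane.I, 0)
  let E := FundamentalGroupoidFunctor.equivOfHomotopyEquiv e
  let X : FundamentalGroupoid D₁.Surface := ⟨D₁.proj x⟩
  let Y : FundamentalGroupoid D₂.Surface := E.functor.obj X
  obtain ⟨y, hy⟩ := D₂.surjective_proj Y.as
  let e₁ : FundamentalGroup D₁.Surface (D₁.proj x) ≃* D₁.groupᵐᵒᵖ :=
    D₁.isQuotientCoveringMap_proj.fundamentalGroupEquiv ⟨x, rfl⟩
  let e₂ : FundamentalGroup D₂.Surface Y.as ≃* D₂.groupᵐᵒᵖ :=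
    D₂.isQuotientCoveringMap_proj.fundamentalGroupEquiv ⟨y, hy⟩
  let e₃ : FundamentalGroup D₁.Surface (D₁.proj x) ≃* FundamentalGroup D₂.Surface Y.as :=
    E.fullyFaithfulFunctor.mulEquivEnd X
  exact ⟨MulEquiv.op.symm ((e₁.symm.trans e₃).trans e₂)⟩

lemma famProj_zero (x : ℍ × ℂ) : D.famProj (x, 0) = (D.proj x, 0) := by
  change (D.proj (shiftSnd (-(D.height x * 0)) x), _) = _
  rw [mul_zero, neg_zero, shiftSnd_zero]

/-- Over the family of `D₂`, the surface of `D₂` is the fibre over `0`, and the surface of `D₁` is the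
fibre over the negative of the change of `t` in `SPlusData.exists_intertwining`. -/
theorem deformationEquivalent_of_mulEquiv (φ : D₁.group ≃* D₂.group)
    (hdeg : ∀ γ, D₂.deg (φ γ) = D₁.deg γ) (l : {s : ℝ // 0 < s})
    (hA : ∀ γ, D₁.deg γ = 0 → D₂.trA (φ γ) = l * D₁.trA γ) :
    DeformationEquivalent model model D₁.Surface D₂.Surface := by
  obtain ⟨σ, μ, β, hμ, t, hT⟩ := exists_intertwining φ hdeg l hA
  refine ⟨(ℂ × ℂ) × ℂ, inferInstance, inferInstance, (ℂ × ℂ) × ℂ, inferInstance,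
    𝓘(ℂ, (ℂ × ℂ) × ℂ), ℂ, inferInstance, inferInstance, ℂ, inferInstance, 𝓘(ℂ, ℂ), D₂.Family,
    inferInstance, inferInstance, ℂ, inferInstance, inferInstance, D₂.isComplexManifold_family,
    inferInstance, ⟨inferInstance, inferInstance, inferInstance, inferInstance, inferInstance⟩,
    inferInstance, D₂.famBase, D₂.isSubmersion_famBase, D₂.isProperMap_famBase, -t, 0,
    fibreBiholomorphic_of_affineHomeo l σ μ β hμ (-t) fun x y => ?_,
    fibreBiholomorphic_of_affineHomeo 1 0 1 0 one_ne_zero 0 fun x y => ?_⟩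
  · set T := affineHomeo l σ μ β hμ
    have hact (γ : D₁.group) : D₂.famAct (φ γ) (T x, -t) = (T (γ • x), -t) := by
      refine Prod.ext ?_ rfl
      simp only [famAct]
      rw [hT, shiftSnd_shiftSnd, hdeg, mul_neg, neg_add_cancel, shiftSnd_zero]
    rw [famProj_eq_iff, eq_comm, D₁.proj_eq_iff]
    constructor
    · rintro ⟨γ, rfl⟩
      exact ⟨φ γ, (hact γ).symm⟩
    · rintro ⟨γ, hγ⟩
      obtain ⟨γ, rfl⟩ := φ.surjective γ
      rw [hact] at hγ
      exact ⟨γ, (T.injective (congrArg Prod.fst hγ)).symm⟩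
  · have hid (x : ℍ × ℂ) : affineHomeo 1 0 1 0 one_ne_zero x = x :=
      Prod.ext (UpperHalfPlane.ext (by rw [affineHomeo_coe_fst]; simp))
        (by rw [affineHomeo_snd]; simp)
    rw [hid, hid, famProj_zero, famProj_zero]
    exact ⟨fun h => by rw [h], fun h => congrArg (fun x : D₂.Family => x.1) h⟩

/-- Two surfaces are deformation equivalent if isomorphisms of their groups with a third group have
the same invariants. -/
lemma deformationEquivalent_of_signedTr (φ₁ : D₁.group ≃* D.group) (φ₂ : D₂.group ≃* D.group)
    {ε : ℤ} (hε : ε ≠ 0) {l₁ l₂ : ℝ} (hl₂ : l₂ ≠ 0) (hl : 0 < l₁ / l₂)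
    (h₁ : ∀ γ, D.deg (φ₁ γ) = ε * D₁.deg γ) (h₂ : ∀ γ, D.deg (φ₂ γ) = ε * D₂.deg γ)
    (hA₁ : ∀ γ, D₁.deg γ = 0 → D.signedTr ε (φ₁ γ) = l₁ * D₁.trA γ)
    (hA₂ : ∀ γ, D₂.deg γ = 0 → D.signedTr ε (φ₂ γ) = l₂ * D₂.trA γ) :
    DeformationEquivalent model model D₁.Surface D₂.Surface := by
  have hφ (γ : D₁.group) : φ₂ (φ₁.trans φ₂.symm γ) = φ₁ γ := φ₂.apply_symm_apply _
  have hdeg (γ : D₁.group) : D₂.deg (φ₁.trans φ₂.symm γ) = D₁.deg γ := by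
    have := h₂ (φ₁.trans φ₂.symm γ)
    rw [hφ, h₁] at this
    exact (mul_left_cancel₀ hε this).symm
  refine deformationEquivalent_of_mulEquiv (φ₁.trans φ₂.symm) hdeg ⟨l₁ / l₂, hl⟩ fun γ hγ => ?_
  have := hA₂ (φ₁.trans φ₂.symm γ) ((hdeg γ).trans hγ)
  rw [hφ, hA₁ γ hγ] at this
  rw [div_mul_eq_mul_div, this, mul_div_cancel_left₀ _ hl₂]

/-- The surfaces homotopy equivalent to a given one fall into families indexed by two signs: that
of `ε` and that of `l` in `SPlusData.exists_signedTr_map_eq`. -/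
theorem exists_families (D : SPlusData) :
    ∃ κ : {D' : SPlusData // Nonempty (ContinuousMap.HomotopyEquiv D'.Surface D.Surface)} →
        Fin 16,
      ∀ D₁ D₂, κ D₁ = κ D₂ → DeformationEquivalent model model D₁.1.Surface D₂.1.Surface := by
  have key (D' : {D' : SPlusData //
      Nonempty (ContinuousMap.HomotopyEquiv D'.Surface D.Surface)}) :=
    exists_signedTr_map_eq (nonempty_mulEquiv_of_homotopyEquiv D'.2.some).some
  choose ε l hε hl hdeg hA using key
  refine ⟨fun D' => if ε D' = 1 then (if 0 < l D' then 0 else 1)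
    else (if 0 < l D' then 2 else 3), fun D₁ D₂ h => ?_⟩
  -- only four of the sixteen indices are used
  obtain ⟨h1, h2⟩ : ε D₁ = ε D₂ ∧ (0 < l D₁ ↔ 0 < l D₂) := by
    have e1 := hε D₁
    have e2 := hε D₂
    dsimp only at h
    split_ifs at h <;> first | exact absurd h (by decide) | exact ⟨by omega, by tauto⟩
  have hε0 : ε D₁ ≠ 0 := by rcases hε D₁ with h | h <;> rw [h] <;> decide
  refine deformationEquivalent_of_signedTr _ _ hε0 (hl D₂) ?_ (hdeg D₁)
    (by rw [h1]; exact hdeg D₂) (hA D₁) (by rw [h1]; exact hA D₂)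
  rcases (hl D₁).lt_or_gt with h | h
  · exact div_pos_of_neg_of_neg h ((hl D₂).lt_or_gt.resolve_right fun h' => h.not_gt (h2.2 h'))
  · exact div_pos h (h2.1 h)

end SPlusData

end

/-- Fix an Inoue surface of type `S⁺`. The Inoue surfaces of type `S⁺` homotopy equivalent to it form
at most 16 deformation equivalence classes. Moreover (without passing to the generated equivalence
relation) they fall into 16 families such that any two members of the same family are fibres of one
smooth proper holomorphic map over a connected base. -/
theorem mainTheorem3 (D : SPlusData) :
    ((fun D' : SPlusData => (Quotient.mk SPlusData.deformationSetoid D')) ''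
        {D' : SPlusData |
          Nonempty (ContinuousMap.HomotopyEquiv D'.Surface D.Surface)}).encard ≤ 16 ∧
    ∃ κ : {D' : SPlusData //
          Nonempty (ContinuousMap.HomotopyEquiv D'.Surface D.Surface)} → Fin 16,
      ∀ D₁ D₂, κ D₁ = κ D₂ →
        DeformationEquivalent SPlusData.model SPlusData.model D₁.1.Surface D₂.1.Surface := by
  obtain ⟨κ, hκ⟩ := D.exists_families
  refine ⟨?_, κ, hκ⟩
  set S := (fun D' : SPlusData => (Quotient.mk SPlusData.deformationSetoid D')) ''
    {D' : SPlusData | Nonempty (ContinuousMap.HomotopyEquiv D'.Surface D.Surface)}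
  have hS (c : S) : ∃ D', Quotient.mk SPlusData.deformationSetoid D'.1 = c.1 ∧
      ∃ i, κ D' = i := by
    obtain ⟨D', hD', hc⟩ := c.2
    exact ⟨⟨D', hD'⟩, hc, _, rfl⟩
  -- choosing a representative of each class embeds the classes into the index set of the families
  choose d hd i hi using hS
  have hinj : Function.Injective i := fun c c' h => by
    refine Subtype.ext ?_
    rw [← hd c, ← hd c']
    exact Quotient.sound (Relation.EqvGen.rel _ _ (hκ _ _ (by rw [hi, hi, h])))
  have := ENat.card_le_card_of_injective hinj
  rwa [ENat.card_coe_set_eq, ENat.card_eq_coe_fintype_card, Fintype.card_fin] at this
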